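/- Let $F$ be a field of characteristic $2$. For a finite-dimensional central simple $F$-algebra $A$ of degree $n$ (that is, $\dim_F A=n^2$) and $a\in A$, let $\mathrm{Prd}_{A,a}(x)=x^n-t_1(a)x^{n-1}+t_2(a)x^{n-2}-\cdots+(-1)^nt_n(a)\in F[x]$ be the reduced characteristic polynomial of $a$, i.e. $\mathrm{Prd}_{A,a}(x)=\det(xI_n-\varphi(1\otimes a))$ for any splitting field $E\supseteq F$ and any isomorphism $\varphi:E\otimes_FA\to M_n(E)$ (with $t_2=0$ if $n=1$). Put $A_0=\ker t_1$. The second trace form of $A$ is the quadratic form $T_{A/F}=(A,t_2)$ if $n$ is even, and $T_{A/F}=(A_0,t_2|_{A_0})$ if $n$ is odd. For $a,b\in F$ let $[a,b]$ be the binary quadratic form $ax^2+xy+by^2$, let $\mathbb{H}=[0,0]$ be the hyperbolic plane, let $\perp$ denote the orthogonal sum and let $m\,\mathbb{H}$ denote the orthogonal sum of $m$ copies of $\mathbb{H}$. Let $A_1,A_2$ be finite-dimensional central simple $F$-algebras of degrees $n_1,n_2$. Then $T_{A_1\otimes_F A_2/F}$ is isometric to \[ \begin{cases} T_{A_1/F}\perp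 T_{A_2/F}\perp\frac{(n_1^2-1)(n_2^2-1)}{2}\,\mathbb{H} & \text{if } n_1,n_2 \text{ are odd},\\[2pt] [1,1]\perp\left(\frac{n_1^2n_2^2}{2}-1\right)\mathbb{H} & \text{if } n_1\equiv n_2\equiv 2 \bmod 4,\\[2pt] \frac{n_1^2n_2^2}{2}\,\mathbb{H} & \text{if } n_i\equiv 0 \bmod 4 \text{ and } n_j \text{ is even},\\[2pt] T_{A_i/F}\perp\frac{n_i^2(n_j^2-1)}{2}\,\mathbb{H} & \text{if } n_i\equiv 0\bmod 4 \text{ and } n_j \text{ is odd, or } n_i\equiv 2\bmod 4 \text{ and } n_j\equiv 1\bmod 4,\\[2pt] [1,1]\perp T_{A_i/F}\perp\left(\frac{n_i^2(n_j^2-1)}{2}-1\right)\mathbb{H} & \text{if } n_i\equiv 2\bmod 4 \text{ and } n_j\equiv 3\bmod 4, \end{cases} \] where $\{i,j\}=\{1,2\}$. -/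

import Mathlib

open scoped TensorProduct Polynomial

universe u v w

noncomputable section

namespace SecondTrace

/-- The degree of a central simple algebra `A` over `F`: the integer `n` with `dim_F A = n ^ 2`. -/
def degree (F : Type u) (A : Type v) [Field F] [Ring A] [Algebra F A] : ℕ :=
  Nat.sqrt (Module.finrank F A)

/-- `P : A → F[X]` is the reduced characteristic polynomial of `A`, computed from a splitting field
`E` and an isomorphism `φ : E ⊗ A ≃ M_n(E)`, `n = deg A`: the polynomial `P a` has coefficients in
`F` and equals `det (x I_n - φ a)` over `E`. -/
def IsReducedCharpoly (F : Type u) (A : Type v) [Field F] [Ring A] [Algebra F A]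
    (P : A → F[X]) : Prop :=
  ∃ (E : Type u) (_ : Field E) (_ : Algebra F E)
    (φ : E ⊗[F] A ≃ₐ[E] Matrix (Fin (degree F A)) (Fin (degree F A)) E),
    ∀ a : A, (P a).map (algebraMap F E) = (φ (1 ⊗ₜ[F] a)).charpoly

open Classical in
/-- The reduced characteristic polynomial `Prd_{A,a}(x)` of `a : A`.  For a (finite-dimensional)
central simple algebra it exists and does not depend on `E` and `φ`; the value `0` is used only for
algebras that have no reduced characteristic polynomial. -/
def reducedCharpoly (F : Type u) (A : Type v) [Field F] [Ring A] [Algebra F A] : A → F[X] :=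
  if h : ∃ P : A → F[X], IsReducedCharpoly F A P then h.choose else 0

/-- The functions `t_k` with `Prd_{A,a}(x) = x^n - t_1(a) x^{n-1} + t_2(a) x^{n-2} - ⋯`, where
`n = deg A` (and `t_k = 0` for `k > n`). -/
def redCoeff (F : Type u) (A : Type v) [Field F] [Ring A] [Algebra F A] (k : ℕ) (a : A) : F :=
  if k ≤ degree F A then (-1) ^ k * (reducedCharpoly F A a).coeff (degree F A - k) else 0

section Aux

variable (F : Type u) (A : Type v) [Field F] [Ring A] [Algebra F A]

theorem redCoeff_spec (h : ∃ P : A → F[X], IsReducedCharpoly F A P) :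
    ∃ (E : Type u) (_ : Field E) (_ : Algebra F E)
      (φ : A →ₗ[F] Matrix (Fin (degree F A)) (Fin (degree F A)) E),
      ∀ (k : ℕ) (a : A), k ≤ degree F A →
        algebraMap F E (redCoeff F A k a) = (-1) ^ k * (φ a).charpoly.coeff (degree F A - k) := by
  obtain ⟨E, i₁, i₂, φ, hφ⟩ := h.choose_spec
  refine ⟨E, i₁, i₂, (φ.toLinearMap.restrictScalars F).comp
    (Algebra.TensorProduct.includeRight (R := F) (A := E) (B := A)).toLinearMap, ?_⟩
  intro k a hk
  have := hφ a
  simp only [redCoeff, hk, if_true, reducedCharpoly, dif_pos h, map_mul, map_pow, map_neg, map_one]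
  rw [← Polynomial.coeff_map, this]
  rfl

theorem redCoeff_eq_zero (h : ¬ ∃ P : A → F[X], IsReducedCharpoly F A P) (k : ℕ) (a : A) :
    redCoeff F A k a = 0 := by
  simp [redCoeff, reducedCharpoly, dif_neg h]

theorem redCoeff_one_trace (h : ∃ P : A → F[X], IsReducedCharpoly F A P) :
    ∃ (E : Type u) (_ : Field E) (_ : Algebra F E) (t : A →ₗ[F] E),
      ∀ a : A, algebraMap F E (redCoeff F A 1 a) = t a := by
  obtain ⟨E, i₁, i₂, φ, hφ⟩ := redCoeff_spec F A h
  by_cases hn : 1 ≤ degree F A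
  · refine ⟨E, i₁, i₂, (Matrix.traceLinearMap _ F E).comp φ, fun a => ?_⟩
    have : Nonempty (Fin (degree F A)) := ⟨⟨0, hn⟩⟩
    rw [hφ 1 a hn]
    simp [Matrix.trace_eq_neg_charpoly_coeff]
  · exact ⟨E, i₁, i₂, 0, fun a => by simp [redCoeff, hn]⟩

theorem exists_matrix_quadraticForm (E : Type u) [Field E] (n : ℕ) (hn : 2 ≤ n) :
    ∃ Q : QuadraticForm E (Matrix (Fin n) (Fin n) E),
      ∀ M, Q M = M.charpoly.coeff (n - 2) := by
  classical
  have key : ∀ s ∈ (Finset.univ : Finset (Fin n)).powersetCard 2,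
      ∃ Q : QuadraticForm E (Matrix (Fin n) (Fin n) E),
        ∀ M, Q M = (M.submatrix (Subtype.val : s → Fin n) (Subtype.val : s → Fin n)).det := by
    intro s hs
    have hc : s.card = 2 := (Finset.mem_powersetCard.mp hs).2
    let e := (s.equivFinOfCardEq hc).symm
    let ent : Fin n → Fin n → (Matrix (Fin n) (Fin n) E →ₗ[E] E) :=
      fun i j => Matrix.entryLinearMap E E i j
    refine ⟨QuadraticMap.linMulLin (ent (e 0) (e 0)) (ent (e 1) (e 1)) -
      QuadraticMap.linMulLin (ent (e 0) (e 1)) (ent (e 1) (e 0)), fun M => ?_⟩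
    rw [← Matrix.det_submatrix_equiv_self e, Matrix.det_fin_two]
    simp [ent]
  choose! Q hQ using key
  refine ⟨∑ s ∈ (Finset.univ : Finset (Fin n)).powersetCard 2, Q s, fun M => ?_⟩
  have := Matrix.charpoly_coeff_eq_sum_minors M 2 (by simpa using hn)
  simp only [Fintype.card_fin] at this
  rw [this, _root_.sum_apply, Finset.sum_congr rfl (fun s hs => hQ s hs M)]
  simp

theorem redCoeff_two_quadratic (h : ∃ P : A → F[X], IsReducedCharpoly F A P) :
    ∃ (E : Type u) (_ : Field E) (_ : Algebra F E) (q : QuadraticMap F A E),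
      ∀ a : A, algebraMap F E (redCoeff F A 2 a) = q a := by
  obtain ⟨E, i₁, i₂, φ, hφ⟩ := redCoeff_spec F A h
  by_cases hn : 2 ≤ degree F A
  · obtain ⟨Q, hQ⟩ := exists_matrix_quadraticForm E (degree F A) hn
    refine ⟨E, i₁, i₂, (Q.restrictScalars (S := F)).comp φ, fun a => ?_⟩
    rw [hφ 2 a hn]
    simp [hQ]
  · exact ⟨E, i₁, i₂, 0, fun a => by simp [redCoeff, hn]⟩

end Aux

/-- The reduced trace `t_1 = Trd_A`, as a linear form. -/
def reducedTrace (F : Type u) (A : Type v) [Field F] [Ring A] [Algebra F A] : A →ₗ[F] F where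
  toFun a := redCoeff F A 1 a
  map_add' a b := by
    by_cases h : ∃ P : A → F[X], IsReducedCharpoly F A P
    · obtain ⟨E, _, _, t, ht⟩ := redCoeff_one_trace F A h
      apply (algebraMap F E).injective
      rw [map_add, ht, ht, ht, map_add]
    · simp [redCoeff_eq_zero F A h]
  map_smul' c a := by
    by_cases h : ∃ P : A → F[X], IsReducedCharpoly F A P
    · obtain ⟨E, _, _, t, ht⟩ := redCoeff_one_trace F A h
      apply (algebraMap F E).injective
      rw [RingHom.id_apply, smul_eq_mul, map_mul, ht, ht, map_smul, Algebra.smul_def]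
    · simp [redCoeff_eq_zero F A h]

/-- The second coefficient `t_2` of the reduced characteristic polynomial, as a quadratic form
on `A`. -/
def t2Form (F : Type u) (A : Type v) [Field F] [Ring A] [Algebra F A] : QuadraticForm F A :=
  QuadraticMap.ofPolar (fun a => redCoeff F A 2 a)
    (fun c a => by
      by_cases h : ∃ P : A → F[X], IsReducedCharpoly F A P
      · obtain ⟨E, _, _, q, hq⟩ := redCoeff_two_quadratic F A h
        apply (algebraMap F E).injective
        rw [smul_eq_mul, map_mul, hq, hq, QuadraticMap.map_smul, Algebra.smul_def]
      · simp [redCoeff_eq_zero F A h])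
    (fun a a' b => by
      by_cases h : ∃ P : A → F[X], IsReducedCharpoly F A P
      · obtain ⟨E, _, _, q, hq⟩ := redCoeff_two_quadratic F A h
        apply (algebraMap F E).injective
        have := QuadraticMap.polar_add_left q a a' b
        simpa only [QuadraticMap.polar, map_add, map_sub, hq] using this
      · simp [QuadraticMap.polar, redCoeff_eq_zero F A h])
    (fun c a b => by
      by_cases h : ∃ P : A → F[X], IsReducedCharpoly F A P
      · obtain ⟨E, _, _, q, hq⟩ := redCoeff_two_quadratic F A h
        apply (algebraMap F E).injective
        have := QuadraticMap.polar_smul_left q c a b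
        simpa only [QuadraticMap.polar, map_sub, map_mul, smul_eq_mul, hq, Algebra.smul_def]
          using this
      · simp [QuadraticMap.polar, redCoeff_eq_zero F A h])

/-- The space of `T_{A/F}`: all of `A` if `deg A` is even, and `A_0 = ker t_1` if `deg A` is
odd. -/
def traceSpace (F : Type u) (A : Type v) [Field F] [Ring A] [Algebra F A] : Submodule F A :=
  if Even (degree F A) then ⊤ else LinearMap.ker (reducedTrace F A)

/-- The (reduced) second trace form `T_{A/F}`: `(A, t_2)` if `deg A` is even, and `(A_0, t_2)` if
`deg A` is odd. -/
def secondTraceForm (F : Type u) (A : Type v) [Field F] [Ring A] [Algebra F A] :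
    QuadraticForm F (traceSpace F A) :=
  (t2Form F A).comp (traceSpace F A).subtype

/-- The binary quadratic form `[a, b] = a x² + x y + b y²`. -/
def binaryForm (F : Type u) [Field F] (a b : F) : QuadraticForm F (F × F) :=
  a • QuadraticMap.linMulLin (LinearMap.fst F F F) (LinearMap.fst F F F) +
    QuadraticMap.linMulLin (LinearMap.fst F F F) (LinearMap.snd F F F) +
    b • QuadraticMap.linMulLin (LinearMap.snd F F F) (LinearMap.snd F F F)

/-- `m ℍ`: the orthogonal sum of `m` copies of the hyperbolic plane `ℍ = [0, 0]`. -/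
def hyperbolic (F : Type u) [Field F] (m : ℕ) : QuadraticForm F (Fin m → F × F) :=
  QuadraticMap.pi fun _ => binaryForm F 0 0

end SecondTrace

end

/-! Everything follows from two formulas. The polar form of `t₂` is `t₁(a)t₁(b) - t₁(ab)`, and in
characteristic 2 the second coefficient of `a ⊗ b` is `t₁(a)² t₂(b) + t₂(a) t₁(b)²`. The first with
`b = a` gives `t₁(a²) = t₁(a)²`, so the trace form is alternating on `A₀ = ker t₁`, and `A₀`
contains a totally isotropic `L` of at least half its dimension. Then `L ⊗ B₀` is totally singular
for `t₂` and orthogonal to both `A ⊗ 1` and `1 ⊗ B`.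

The engine is `equivalent_prod_hyperbolic`: in a nondegenerate space, a subspace `U` together with a
totally singular `W` orthogonal to it, of dimension as large as possible, splits the space as `U`
plus hyperbolic planes. For odd degrees, `U = A₀ ⊗ 1 + 1 ⊗ B₀`. For `A` even and `B` odd, `U = A ⊗
1`. For even degrees, `U` is a plane spanned by `1 ⊗ b₀` and `a₀ ⊗ 1` with `t₁(a₀) = t₁(b₀) = 1`,
and `W` is enlarged by `C ⊗ 1`, with `C` a complement of `L` in `A₀`.

In the mixed case `U` carries `t₂ + binom(n_B, 2) t₁²`. As `n_A` is even, `t₁` is the polar of `t₂`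
with `1`, so the extra square is removed by `x ↦ x + t₁(x)1` if `t₂(1) = binom(n_A, 2)` vanishes in
`F`; if it is 1, removing it trades a hyperbolic plane for `[1,1]`.

The preliminaries make `t₁` and `t₂` computable: central simple algebras are closed under tensor
products and split over the separable closure, and the reduced characteristic polynomial descends to
`F` independently of the splitting. -/

noncomputable section

namespace SecondTrace

/-! ### Tensor products of central simple algebras. -/

section CentralSimple

variable {K : Type*} [Field K] {A B : Type*} [Ring A] [Ring B] [Algebra K A] [Algebra K B]

lemma basis_repr_tmul_one_mul {ι : Type*} (b : Module.Basis ι K B) (a : A) (x : A ⊗[K] B) (i : ι) :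
    (Algebra.TensorProduct.basis A b).repr ((a ⊗ₜ 1) * x) i =
      a * (Algebra.TensorProduct.basis A b).repr x i := by
  induction x using TensorProduct.induction_on with
  | zero => simp
  | tmul x y => simp [mul_assoc]
  | add x y hx hy => simp [mul_add, hx, hy]

lemma basis_repr_mul_tmul_one {ι : Type*} (b : Module.Basis ι K B) (a : A) (x : A ⊗[K] B) (i : ι) :
    (Algebra.TensorProduct.basis A b).repr (x * (a ⊗ₜ 1)) i =
      (Algebra.TensorProduct.basis A b).repr x i * a := by
  induction x using TensorProduct.induction_on with
  | zero => simp
  | tmul x y => simp [mul_assoc, Algebra.commutes]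
  | add x y hx hy => simp [add_mul, hx, hy]

/-- The centralizer of `A ⊗ 1` in `A ⊗ B`, for `A` central, is `1 ⊗ B`. -/
lemma exists_eq_one_tmul_of_commute [Algebra.IsCentral K A] (x : A ⊗[K] B)
    (hx : ∀ a : A, (a ⊗ₜ 1) * x = x * (a ⊗ₜ 1)) : ∃ y : B, x = 1 ⊗ₜ y := by
  let b := Module.Basis.ofVectorSpace K B
  let b' := Algebra.TensorProduct.basis A b
  -- The coordinates of `x` in the `A`-basis `1 ⊗ bᵢ` commute with all of `A`, so they are scalars.
  have hc : ∀ i, ∃ c : K, algebraMap K A c = b'.repr x i := fun i => by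
    have : b'.repr x i ∈ Subalgebra.center K A := by
      rw [Subalgebra.mem_center_iff]
      intro a
      rw [← basis_repr_tmul_one_mul, hx, basis_repr_mul_tmul_one]
    rw [Algebra.IsCentral.center_eq_bot] at this
    exact Algebra.mem_bot.1 this
  choose c hc using hc
  refine ⟨∑ i ∈ (b'.repr x).support, c i • b i, ?_⟩
  conv_lhs => rw [← b'.linearCombination_repr x, Finsupp.linearCombination_apply, Finsupp.sum]
  rw [TensorProduct.tmul_sum]
  refine Finset.sum_congr rfl fun i _ => ?_
  rw [← hc]
  simp [b', Algebra.TensorProduct.basis_apply, TensorProduct.smul_tmul', TensorProduct.tmul_smul,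
    Algebra.algebraMap_eq_smul_one]

/-- Shortest-element argument: simplicity of `A` normalizes one coordinate of a nonzero element of
minimal support to 1; its commutators with `A ⊗ 1` are then shorter, hence zero, so it centralizes
`A ⊗ 1`. -/
lemma exists_one_tmul_mem [Algebra.IsCentral K A] [IsSimpleRing A] (I : TwoSidedIdeal (A ⊗[K] B))
    (hI : I ≠ ⊥) : ∃ y : B, y ≠ 0 ∧ (1 : A) ⊗ₜ[K] y ∈ I := by
  classical
  let b := Module.Basis.ofVectorSpace K B
  let b' := Algebra.TensorProduct.basis A b
  have hex : ∃ n : ℕ, ∃ x ∈ I, x ≠ 0 ∧ (b'.repr x).support.card = n := by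
    by_contra! h
    refine hI (eq_bot_iff.2 fun x hx => ?_)
    rw [TwoSidedIdeal.mem_bot]
    by_contra h0
    exact h _ x hx h0 rfl
  obtain ⟨x, hxI, hx0, hxn⟩ := Nat.find_spec hex
  have hmin : ∀ z ∈ I, (b'.repr z).support ⊂ (b'.repr x).support → z = 0 := by
    intro z hz hss
    by_contra h0
    have := Nat.find_min' hex ⟨z, hz, h0, rfl⟩
    have := Finset.card_lt_card hss
    omega
  obtain ⟨i, hi⟩ : (b'.repr x).support.Nonempty := by
    rw [Finsupp.support_nonempty_iff]
    simpa using hx0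
  -- The `i`-th coordinates of those elements of `I` whose support lies in that of `x`.
  let J : TwoSidedIdeal A := TwoSidedIdeal.mk'
    {a | ∃ z ∈ I, (∀ j, b'.repr x j = 0 → b'.repr z j = 0) ∧ b'.repr z i = a}
    ⟨0, I.zero_mem, by simp, by simp⟩
    (by
      rintro _ _ ⟨z, hz, hs, rfl⟩ ⟨z', hz', hs', rfl⟩
      exact ⟨z + z', I.add_mem hz hz', fun j hj => by simp [hs j hj, hs' j hj], by simp⟩)
    (by
      rintro _ ⟨z, hz, hs, rfl⟩
      exact ⟨-z, I.neg_mem hz, fun j hj => by simp [hs j hj], by simp⟩)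
    (by
      rintro a _ ⟨z, hz, hs, rfl⟩
      exact ⟨(a ⊗ₜ 1) * z, I.mul_mem_left _ _ hz,
        fun j hj => by rw [basis_repr_tmul_one_mul, hs j hj, mul_zero],
        basis_repr_tmul_one_mul _ _ _ _⟩)
    (by
      rintro _ a ⟨z, hz, hs, rfl⟩
      exact ⟨z * (a ⊗ₜ 1), I.mul_mem_right _ _ hz,
        fun j hj => by rw [basis_repr_mul_tmul_one, hs j hj, zero_mul],
        basis_repr_mul_tmul_one _ _ _ _⟩)
  have hJ : (1 : A) ∈ J := by
    refine IsSimpleRing.one_mem_of_ne_zero_mem J (x := b'.repr x i) (by simpa using hi) ?_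
    rw [TwoSidedIdeal.mem_mk']
    exact ⟨x, hxI, fun _ h => h, rfl⟩
  rw [TwoSidedIdeal.mem_mk'] at hJ
  obtain ⟨z, hz, hs, hz1⟩ := hJ
  obtain ⟨y, rfl⟩ := exists_eq_one_tmul_of_commute z fun a => by
    rw [← sub_eq_zero]
    refine hmin _ (I.sub_mem (I.mul_mem_left _ _ hz) (I.mul_mem_right _ _ hz)) ?_
    rw [Finset.ssubset_iff_of_subset]
    · refine ⟨i, hi, ?_⟩
      rw [Finsupp.notMem_support_iff, map_sub, Finsupp.sub_apply, basis_repr_tmul_one_mul,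
        basis_repr_mul_tmul_one, hz1, mul_one, one_mul, sub_self]
    · intro j hj
      rw [Finsupp.mem_support_iff] at hj ⊢
      contrapose! hj
      rw [map_sub, Finsupp.sub_apply, basis_repr_tmul_one_mul, basis_repr_mul_tmul_one, hs j hj,
        mul_zero, zero_mul, sub_self]
  refine ⟨y, ?_, hz⟩
  rintro rfl
  simp at hz1

instance isSimpleRing_tensorProduct [Algebra.IsCentral K A] [IsSimpleRing A] [IsSimpleRing B] :
    IsSimpleRing (A ⊗[K] B) := by
  refine IsSimpleRing.of_eq_bot_or_eq_top fun I => or_iff_not_imp_left.2 fun hI => ?_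
  obtain ⟨y, hy0, hy⟩ := exists_one_tmul_mem I hI
  let J : TwoSidedIdeal B := I.comap (Algebra.TensorProduct.includeRight : B →ₐ[K] A ⊗[K] B)
  have : (1 : B) ∈ J := IsSimpleRing.one_mem_of_ne_zero_mem J hy0 (by
    rw [TwoSidedIdeal.mem_comap]; exact hy)
  rw [TwoSidedIdeal.mem_comap] at this
  rw [← TwoSidedIdeal.one_mem_iff]
  exact this

instance isCentral_tensorProduct [Algebra.IsCentral K A] [Algebra.IsCentral K B] [Nontrivial A] :
    Algebra.IsCentral K (A ⊗[K] B) where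
  out x hx := by
    rw [Subalgebra.mem_center_iff] at hx
    obtain ⟨y, rfl⟩ := exists_eq_one_tmul_of_commute x fun a => hx _
    have hy : y ∈ Subalgebra.center K B := by
      rw [Subalgebra.mem_center_iff]
      intro b
      have := hx (1 ⊗ₜ b)
      simp only [Algebra.TensorProduct.tmul_mul_tmul, mul_one] at this
      exact Algebra.TensorProduct.includeRight_injective
        (FaithfulSMul.algebraMap_injective K A) this
    rw [Algebra.IsCentral.center_eq_bot] at hy
    obtain ⟨c, rfl⟩ := Algebra.mem_bot.1 hy
    exact Algebra.mem_bot.2 ⟨c, by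
      rw [Algebra.TensorProduct.algebraMap_apply, Algebra.algebraMap_eq_smul_one,
        Algebra.algebraMap_eq_smul_one, TensorProduct.smul_tmul]⟩

variable (E : Type*) [Field E] [Algebra K E]

lemma isSimpleRing_baseChange [Algebra.IsCentral K A] [IsSimpleRing A] :
    IsSimpleRing (E ⊗[K] A) :=
  IsSimpleRing.of_ringEquiv (Algebra.TensorProduct.comm K A E).toRingEquiv inferInstance

lemma isCentral_baseChange [Algebra.IsCentral K A] : Algebra.IsCentral E (E ⊗[K] A) where
  out x hx := by
    rw [Subalgebra.mem_center_iff] at hx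
    let c := Algebra.TensorProduct.comm K E A
    obtain ⟨y, hy⟩ := exists_eq_one_tmul_of_commute (c x) fun a => by
      have := congrArg c (hx (1 ⊗ₜ a))
      simpa [c] using this
    refine Algebra.mem_bot.2 ⟨y, c.injective ?_⟩
    rw [hy, Algebra.TensorProduct.algebraMap_apply]
    simp [c]

end CentralSimple

/-! ### Splitting over the separable closure. -/

section Splitting

/-- By Jacobson–Noether a larger `D` would contain a noncentral element separable over `E`, whose
minimal polynomial is linear since `E` is separably closed. -/
lemma divisionAlgebra_algebraMap_bijective {E D : Type*} [Field E] [IsSepClosed E] [DivisionRing D]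
    [Algebra E D] [FiniteDimensional E D] [Algebra.IsCentral E D] :
    Function.Bijective (algebraMap E D) := by
  refine ⟨(algebraMap E D).injective, ?_⟩
  by_contra h
  have hne : (⊥ : Subalgebra E D) ≠ ⊤ := fun h' =>
    h (Algebra.surjective_algebraMap_iff.2 h'.symm)
  obtain ⟨x, hx, hsep⟩ := JacobsonNoether.exists_separable_and_not_isCentral' hne
  have hint : IsIntegral E x := Algebra.IsIntegral.isIntegral x
  have := IsSepClosed.degree_eq_one_of_irreducible E (minpoly.irreducible hint) hsep
  obtain ⟨y, hy⟩ := minpoly.mem_range_of_degree_eq_one E x this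
  exact hx (Algebra.mem_bot.2 ⟨y, hy⟩)

lemma isCentral_of_algEquiv {E R S : Type*} [Field E] [Ring R] [Algebra E R] [Ring S] [Algebra E S]
    (e : R ≃ₐ[E] S) [Algebra.IsCentral E R] : Algebra.IsCentral E S where
  out x hx := by
    rw [Subalgebra.mem_center_iff] at hx
    have : e.symm x ∈ Subalgebra.center E R := by
      rw [Subalgebra.mem_center_iff]
      intro b
      apply e.injective
      simp [hx]
    rw [Algebra.IsCentral.center_eq_bot] at this
    obtain ⟨c, hc⟩ := Algebra.mem_bot.1 this
    exact Algebra.mem_bot.2 ⟨c, by rw [← e.apply_symm_apply x, ← hc, e.commutes]⟩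

lemma exists_algEquiv_matrix_of_isSepClosed (E R : Type*) [Field E] [IsSepClosed E] [Ring R]
    [Algebra E R] [Algebra.IsCentral E R] [IsSimpleRing R] [FiniteDimensional E R] :
    ∃ n : ℕ, Nonempty (R ≃ₐ[E] Matrix (Fin n) (Fin n) E) := by
  have := IsArtinianRing.of_finite E R
  obtain ⟨n, hn, D, _, _, _, ⟨e⟩⟩ := IsSimpleRing.exists_algEquiv_matrix_divisionRing_finite E R
  have : Algebra.IsCentral E (D ⊗[E] Matrix (Fin n) (Fin n) E) :=
    isCentral_of_algEquiv (e.trans (matrixEquivTensor (Fin n) E D))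
  have : Algebra.IsCentral E D :=
    Algebra.IsCentral.left_of_tensor_of_field E D (Matrix (Fin n) (Fin n) E)
  exact ⟨n, ⟨e.trans <| .mapMatrix <| .symm <| .ofBijective (Algebra.ofId E D)
    divisionAlgebra_algebraMap_bijective⟩⟩

lemma finrank_eq_sq_of_algEquiv {F E A : Type*} [Field F] [Field E] [Algebra F E] [Ring A]
    [Algebra F A] {n : ℕ}
    (φ : E ⊗[F] A ≃ₐ[E] Matrix (Fin n) (Fin n) E) : Module.finrank F A = n ^ 2 := by
  rw [← Module.finrank_baseChange (R := E), φ.toLinearEquiv.finrank_eq]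
  simp [Module.finrank_matrix, sq]

/-- Splitting over the separable, not merely the algebraic, closure is what permits Galois descent
of coefficients. -/
lemma exists_splitting (F A : Type*) [Field F] [Ring A] [Algebra F A] [Algebra.IsCentral F A]
    [IsSimpleRing A] [FiniteDimensional F A] :
    Nonempty (SeparableClosure F ⊗[F] A ≃ₐ[SeparableClosure F]
      Matrix (Fin (degree F A)) (Fin (degree F A)) (SeparableClosure F)) := by
  have := isSimpleRing_baseChange (A := A) (K := F) (SeparableClosure F)
  have := isCentral_baseChange (A := A) (K := F) (SeparableClosure F)
  obtain ⟨n, ⟨φ⟩⟩ :=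
    exists_algEquiv_matrix_of_isSepClosed (SeparableClosure F) (SeparableClosure F ⊗[F] A)
  have hn : degree F A = n := by rw [degree, finrank_eq_sq_of_algEquiv φ, Nat.sqrt_eq']
  rw [hn]
  exact ⟨φ⟩

lemma finrank_eq_degree_sq (F A : Type*) [Field F] [Ring A] [Algebra F A] [Algebra.IsCentral F A]
    [IsSimpleRing A] [FiniteDimensional F A] : Module.finrank F A = degree F A ^ 2 := by
  obtain ⟨φ⟩ := exists_splitting F A
  exact finrank_eq_sq_of_algEquiv φ

lemma degree_pos (F A : Type*) [Field F] [Ring A] [Algebra F A] [Algebra.IsCentral F A]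
    [IsSimpleRing A] [FiniteDimensional F A] : 0 < degree F A := by
  have h := finrank_eq_degree_sq F A
  have : 0 < Module.finrank F A := Module.finrank_pos
  rw [h] at this
  exact Nat.pos_of_ne_zero fun h0 => by simp [h0] at this

lemma degree_tensorProduct (F A B : Type*) [Field F] [Ring A] [Algebra F A] [Algebra.IsCentral F A]
    [IsSimpleRing A] [FiniteDimensional F A] [Ring B] [Algebra F B] [Algebra.IsCentral F B]
    [IsSimpleRing B] [FiniteDimensional F B] :
    degree F (A ⊗[F] B) = degree F A * degree F B := by
  rw [degree, Module.finrank_tensorProduct, finrank_eq_degree_sq, finrank_eq_degree_sq, ← mul_pow,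
    Nat.sqrt_eq']

end Splitting

/-! ### Existence and uniqueness of the reduced characteristic polynomial. -/

section Charpoly

lemma toMatrix_lmul_matrix {n R : Type*} [Fintype n] [DecidableEq n] [CommRing R]
    (M : Matrix n n R) :
    LinearMap.toMatrix (Matrix.stdBasis R n n) (Matrix.stdBasis R n n)
      (Algebra.lmul R (Matrix n n R) M) = Matrix.blockDiagonal fun _ => M := by
  ext ⟨i, j⟩ ⟨k, l⟩
  rw [LinearMap.toMatrix_apply, Matrix.stdBasis_eq_single]
  simp [Matrix.stdBasis, Matrix.blockDiagonal_apply]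
  by_cases h : j = l
  · subst h
    simp
  · rw [Matrix.mul_single_apply_of_ne _ _ _ _ _ h, if_neg h]

lemma charpoly_blockDiagonal {n o R : Type*} [Fintype n] [DecidableEq n] [Fintype o]
    [DecidableEq o] [CommRing R] (M : o → Matrix n n R) :
    (Matrix.blockDiagonal M).charpoly = ∏ i, (M i).charpoly := by
  unfold Matrix.charpoly
  rw [← Matrix.det_blockDiagonal]
  congr 1
  ext ⟨i, j⟩ ⟨k, l⟩
  by_cases h : j = l <;>
  simp [Matrix.charmatrix_apply, Matrix.blockDiagonal_apply, Matrix.diagonal_apply, h]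

lemma charpoly_lmul_matrix {n R : Type*} [Fintype n] [DecidableEq n] [CommRing R] [Nontrivial R]
    (M : Matrix n n R) :
    (Algebra.lmul R (Matrix n n R) M).charpoly = M.charpoly ^ Fintype.card n := by
  rw [← LinearMap.charpoly_toMatrix _ (Matrix.stdBasis R n n), toMatrix_lmul_matrix,
    charpoly_blockDiagonal, Finset.prod_const, Finset.card_univ]

/-- Left multiplication by a matrix on `M_n` consists of `n` diagonal copies of it. The right side
involves neither the splitting nor `E` beyond base change; as monic `n`-th roots are unique, this
yields both rationality and independence of `φ`. -/
lemma charpoly_pow_eq {F E A : Type*} [Field F] [Field E] [Algebra F E] [Ring A]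
    [Algebra F A] [FiniteDimensional F A] {n : ℕ}
    (φ : E ⊗[F] A ≃ₐ[E] Matrix (Fin n) (Fin n) E) (a : A) :
    (φ (1 ⊗ₜ a)).charpoly ^ n = (Algebra.lmul F A a).charpoly.map (algebraMap F E) := by
  rw [← LinearMap.charpoly_baseChange, Algebra.baseChange_lmul]
  have h := charpoly_lmul_matrix (φ (1 ⊗ₜ a))
  rw [Fintype.card_fin] at h
  rw [← h, ← LinearEquiv.charpoly_conj φ.toLinearEquiv]
  congr 1
  ext1 M
  simp [LinearEquiv.conj_apply]

lemma eq_of_pow_eq_pow_of_monic {E : Type*} [Field E] {p q : E[X]} (hp : p.Monic) (hq : q.Monic)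
    {n : ℕ} (hn : n ≠ 0) (h : p ^ n = q ^ n) : p = q :=
  Polynomial.eq_of_monic_of_associated hp hq <| associated_of_dvd_dvd
    ((IsIntegrallyClosed.pow_dvd_pow_iff hn).1 h.dvd)
    ((IsIntegrallyClosed.pow_dvd_pow_iff hn).1 h.symm.dvd)

lemma exists_isReducedCharpoly (F : Type*) (A : Type*) [Field F] [Ring A] [Algebra F A]
    [Algebra.IsCentral F A] [IsSimpleRing A] [FiniteDimensional F A] :
    ∃ P : A → F[X], IsReducedCharpoly F A P := by
  obtain ⟨φ⟩ := exists_splitting F A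
  have h : ∀ a : A, ∃ p : F[X],
      p.map (algebraMap F (SeparableClosure F)) = (φ (1 ⊗ₜ[F] a)).charpoly := by
    intro a
    rw [← Polynomial.mem_lifts, Polynomial.lifts_iff_coeff_lifts]
    intro k
    rw [InfiniteGalois.mem_range_algebraMap_iff_fixed]
    intro σ
    have hm := (φ (1 ⊗ₜ[F] a)).charpoly_monic
    -- The `n`-th power has coefficients in `F`, so `σ` fixes it, and therefore fixes its unique
    -- monic root.
    have := eq_of_pow_eq_pow_of_monic (hm.map (σ : SeparableClosure F →+* SeparableClosure F)) hm
      (degree_pos F A).ne' (by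
        rw [← Polynomial.map_pow, charpoly_pow_eq, Polynomial.map_map]
        congr 1
        ext x
        simp)
    conv_rhs => rw [← this]
    simp
  choose P hP using h
  exact ⟨P, SeparableClosure F, inferInstance, inferInstance, φ, hP⟩

lemma map_reducedCharpoly {F : Type*} {A : Type*} [Field F] [Ring A] [Algebra F A]
    [Algebra.IsCentral F A] [IsSimpleRing A] [FiniteDimensional F A] {E : Type*} [Field E]
    [Algebra F E] {n : ℕ} (φ : E ⊗[F] A ≃ₐ[E] Matrix (Fin n) (Fin n) E) (a : A) :
    (reducedCharpoly F A a).map (algebraMap F E) = (φ (1 ⊗ₜ a)).charpoly := by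
  have hn : degree F A = n := by rw [degree, finrank_eq_sq_of_algEquiv φ, Nat.sqrt_eq']
  subst hn
  have hex := exists_isReducedCharpoly F A
  obtain ⟨E', _, _, φ', h'⟩ := hex.choose_spec
  have hP : reducedCharpoly F A = hex.choose := by rw [reducedCharpoly, dif_pos hex]
  rw [← hP] at h'
  have hm : (reducedCharpoly F A a).Monic :=
    Polynomial.monic_of_injective (algebraMap F E').injective (by
      rw [h']; exact Matrix.charpoly_monic _)
  have hpow : reducedCharpoly F A a ^ degree F A = (Algebra.lmul F A a).charpoly := by
    apply Polynomial.map_injective _ (algebraMap F E').injective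
    rw [Polynomial.map_pow, h', charpoly_pow_eq]
  refine eq_of_pow_eq_pow_of_monic (hm.map _) (Matrix.charpoly_monic _) (degree_pos F A).ne' ?_
  rw [charpoly_pow_eq, ← hpow, Polynomial.map_pow]

/-- Every representation of `A` by matrices of size `deg A` over an extension field computes the
reduced characteristic polynomial. -/
lemma map_reducedCharpoly_algHom {F : Type*} {A : Type*} [Field F] [Ring A] [Algebra F A]
    [Algebra.IsCentral F A] [IsSimpleRing A] [FiniteDimensional F A] {E : Type*} [Field E]
    [Algebra F E] {ι : Type*} [Fintype ι] [DecidableEq ι] (hι : Fintype.card ι = degree F A)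
    (ψ : A →ₐ[F] Matrix ι ι E) (a : A) :
    (reducedCharpoly F A a).map (algebraMap F E) = (ψ a).charpoly := by
  have : Nonempty ι := Fintype.card_pos_iff.1 (hι ▸ degree_pos F A)
  have := isSimpleRing_baseChange (A := A) (K := F) E
  let e := Fintype.equivFin ι
  have hcomm : ∀ (x : E) (y : A), Commute (Algebra.ofId E (Matrix ι ι E) x) (ψ y) :=
    fun x y => Algebra.commutes _ _
  let Ψ : E ⊗[F] A →ₐ[E] Matrix ι ι E := Algebra.TensorProduct.lift (Algebra.ofId _ _) ψ hcomm
  -- Simplicity of `E ⊗ A` gives injectivity; equality of dimensions then makes `Ψ` a splitting.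
  have hinj : Function.Injective Ψ := RingHom.injective (Ψ : E ⊗[F] A →+* Matrix ι ι E)
  have hbij : Function.Bijective Ψ := by
    refine ⟨hinj, ?_⟩
    refine (LinearMap.injective_iff_surjective_of_finrank_eq_finrank (f := Ψ.toLinearMap) ?_).1 hinj
    rw [Module.finrank_baseChange, finrank_eq_degree_sq, Module.finrank_matrix, hι]
    simp [sq]
  have := map_reducedCharpoly ((AlgEquiv.ofBijective Ψ hbij).trans (Matrix.reindexAlgEquiv E E e)) a
  rw [this, AlgEquiv.trans_apply, Matrix.coe_reindexAlgEquiv, Matrix.charpoly_reindex]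
  congr 1
  exact (Algebra.TensorProduct.lift_tmul _ _ hcomm _ _).trans (by simp)

end Charpoly

/-! ### The second coefficient of a matrix as a sum of principal minors. -/

section Matrices

lemma det_submatrix_add_of_card_eq_two
    {ι R : Type*} [DecidableEq ι] [CommRing R] (M N : Matrix ι ι R) {s : Finset ι} (hs : s.card = 2) :
    ((M + N).submatrix (Subtype.val : s → ι) (Subtype.val : s → ι)).det =
      (M.submatrix (Subtype.val : s → ι) (Subtype.val : s → ι)).det +
      (N.submatrix (Subtype.val : s → ι) (Subtype.val : s → ι)).det +
      ∑ p ∈ s.offDiag, (M p.1 p.1 * N p.2 p.2 - M p.1 p.2 * N p.2 p.1) := by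
  let e := (s.equivFinOfCardEq hs).symm
  have hne : (e 0 : ι) ≠ e 1 := fun h => by
    have := e.injective (Subtype.ext h)
    simp at this
  have hs' : {(e 0 : ι), (e 1 : ι)} = s := by
    apply Finset.eq_of_subset_of_card_le
    · intro x hx
      simp only [Finset.mem_insert, Finset.mem_singleton] at hx
      rcases hx with rfl | rfl <;> exact Subtype.prop _
    · rw [Finset.card_pair hne, hs]
  have hmem (x : ι) : x ∈ s ↔ x = e 0 ∨ x = e 1 := by
    conv_lhs => rw [← hs']
    simp
  have hsum : ∑ p ∈ s.offDiag, (M p.1 p.1 * N p.2 p.2 - M p.1 p.2 * N p.2 p.1) =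
      (M (e 0) (e 0) * N (e 1) (e 1) - M (e 0) (e 1) * N (e 1) (e 0)) +
      (M (e 1) (e 1) * N (e 0) (e 0) - M (e 1) (e 0) * N (e 0) (e 1)) := by
    have : s.offDiag = {((e 0 : ι), (e 1 : ι)), ((e 1 : ι), (e 0 : ι))} := by
      ext ⟨x, y⟩
      simp only [Finset.mem_offDiag, hmem, Finset.mem_insert, Finset.mem_singleton, Prod.mk.injEq]
      constructor
      · rintro ⟨rfl | rfl, rfl | rfl, h⟩ <;> simp_all
      · rintro (⟨rfl, rfl⟩ | ⟨rfl, rfl⟩) <;> simp [hne, hne.symm]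
    rw [this, Finset.sum_pair]
    simp [hne]
  rw [hsum, ← Matrix.det_submatrix_equiv_self e, ← Matrix.det_submatrix_equiv_self e (M.submatrix _ _),
    ← Matrix.det_submatrix_equiv_self e (N.submatrix _ _)]
  simp only [Matrix.det_fin_two, Matrix.submatrix_apply, Matrix.add_apply]
  ring

variable {ι κ R S : Type*} [Fintype ι] [DecidableEq ι] [Fintype κ] [DecidableEq κ] [CommRing R]
  [CommRing S]

/-- The sum of the principal minors of size two. -/
def sumMinorsTwo (M : Matrix ι ι R) : R :=
  ∑ s ∈ (Finset.univ : Finset ι).powersetCard 2,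
    (M.submatrix (Subtype.val : s → ι) (Subtype.val : s → ι)).det

lemma sumMinorsTwo_map (f : R →+* S) (M : Matrix ι ι R) :
    sumMinorsTwo (M.map f) = f (sumMinorsTwo M) := by
  simp only [sumMinorsTwo, map_sum, RingHom.map_det]
  rfl

lemma sumMinorsTwo_smul (r : R) (M : Matrix ι ι R) :
    sumMinorsTwo (r • M) = r ^ 2 * sumMinorsTwo M := by
  rw [sumMinorsTwo, sumMinorsTwo, Finset.mul_sum]
  refine Finset.sum_congr rfl fun s hs => ?_
  change (r • M.submatrix (Subtype.val : s → ι) (Subtype.val : s → ι)).det = _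
  rw [Matrix.det_smul, Fintype.card_coe, (Finset.mem_powersetCard.1 hs).2]

lemma sumMinorsTwo_one : sumMinorsTwo (1 : Matrix ι ι R) = (Fintype.card ι).choose 2 := by
  rw [sumMinorsTwo, Finset.sum_congr rfl (g := fun _ => (1 : R)), Finset.sum_const,
    Finset.card_powersetCard, Finset.card_univ, nsmul_one]
  intro s _
  rw [Matrix.submatrix_one _ Subtype.val_injective, Matrix.det_one]

lemma sumMinorsTwo_add (M N : Matrix ι ι R) :
    sumMinorsTwo (M + N) =
      sumMinorsTwo M + sumMinorsTwo N + (M.trace * N.trace - (M * N).trace) := by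
  have h : ∑ s ∈ (Finset.univ : Finset ι).powersetCard 2,
      ∑ p ∈ s.offDiag, (M p.1 p.1 * N p.2 p.2 - M p.1 p.2 * N p.2 p.1) =
        M.trace * N.trace - (M * N).trace := by
    rw [Finset.sum_comm' (t' := Finset.univ.offDiag) (s' := fun p => {{p.1, p.2}})]
    · simp only [Finset.sum_singleton]
      rw [Finset.sum_subset (Finset.subset_univ _), Fintype.sum_prod_type]
      · simp only [Finset.sum_sub_distrib, Matrix.trace, Matrix.diag, Matrix.mul_apply,
          Finset.sum_mul_sum]
      · rintro ⟨x, y⟩ _ hxy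
        simp only [Finset.mem_offDiag, Finset.mem_univ, true_and, not_not] at hxy
        subst hxy
        ring
    · rintro s ⟨x, y⟩
      simp only [Finset.mem_powersetCard, Finset.subset_univ, true_and, Finset.mem_offDiag,
        Finset.mem_singleton, Finset.mem_univ]
      constructor
      · rintro ⟨hs, hx, hy, hxy⟩
        refine ⟨(Finset.eq_of_subset_of_card_le ?_ ?_).symm, hxy⟩
        · simp [Finset.insert_subset_iff, hx, hy]
        · rw [hs, Finset.card_pair hxy]
      · rintro ⟨rfl, hxy⟩
        simp [hxy, Finset.card_pair hxy]
  rw [← h, sumMinorsTwo, sumMinorsTwo, sumMinorsTwo, ← Finset.sum_add_distrib,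
    ← Finset.sum_add_distrib]
  exact Finset.sum_congr rfl fun s hs =>
    det_submatrix_add_of_card_eq_two M N (Finset.mem_powersetCard.1 hs).2

lemma two_mul_sumMinorsTwo (M : Matrix ι ι R) :
    2 * sumMinorsTwo M = M.trace ^ 2 - (M * M).trace := by
  have h1 := sumMinorsTwo_add M M
  rw [← two_smul R M, sumMinorsTwo_smul] at h1
  linear_combination h1

open scoped Kronecker in
-- Twice the identity follows from `two_mul_sumMinorsTwo` and multiplicativity of the trace. To
-- divide by 2, lift to matrices over a polynomial ring over `ℤ` with one variable per element of
-- `R`, then specialize.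
lemma sumMinorsTwo_kronecker (M : Matrix ι ι R) (N : Matrix κ κ R) :
    sumMinorsTwo (M ⊗ₖ N) = M.trace ^ 2 * sumMinorsTwo N + sumMinorsTwo M * N.trace ^ 2 -
      2 * (sumMinorsTwo M * sumMinorsTwo N) := by
  let f : MvPolynomial R ℤ →+* R := (MvPolynomial.aeval (fun r : R => r)).toRingHom
  let M' : Matrix ι ι (MvPolynomial R ℤ) := Matrix.of fun i j => MvPolynomial.X (M i j)
  let N' : Matrix κ κ (MvPolynomial R ℤ) := Matrix.of fun i j => MvPolynomial.X (N i j)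
  have hM : M = M'.map f := by ext; simp [M', f]
  have hN : N = N'.map f := by ext; simp [N', f]
  have key : sumMinorsTwo (M' ⊗ₖ N') = M'.trace ^ 2 * sumMinorsTwo N' +
      sumMinorsTwo M' * N'.trace ^ 2 - 2 * (sumMinorsTwo M' * sumMinorsTwo N') := by
    have h2 : (2 : MvPolynomial R ℤ) ≠ 0 := two_ne_zero
    apply mul_left_cancel₀ h2
    rw [two_mul_sumMinorsTwo, ← Matrix.mul_kronecker_mul, Matrix.trace_kronecker,
      Matrix.trace_kronecker]
    have hM2 := two_mul_sumMinorsTwo M'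
    have hN2 := two_mul_sumMinorsTwo N'
    linear_combination (2 * sumMinorsTwo N' - N'.trace ^ 2) * hM2 - (M' * M').trace * hN2
  have hMt : (M'.map f).trace = f M'.trace := by simp [Matrix.trace]
  have hNt : (N'.map f).trace = f N'.trace := by simp [Matrix.trace]
  have hk : (M'.map f) ⊗ₖ (N'.map f) = (M' ⊗ₖ N').map f := by
    ext
    simp [Matrix.kroneckerMap_apply]
  rw [hM, hN, hk, sumMinorsTwo_map, sumMinorsTwo_map, sumMinorsTwo_map, key, hMt, hNt]
  simp only [map_sub, map_add, map_mul, map_pow, map_ofNat]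

end Matrices

/-! ### Reduced trace and second coefficient of an algebra. -/

section TraceForms

variable {F A : Type*} [Field F] [Ring A] [Algebra F A] [Algebra.IsCentral F A] [IsSimpleRing A]
  [FiniteDimensional F A]

section Representation

variable {E ι : Type*} [Field E] [Algebra F E] [Fintype ι] [DecidableEq ι]

lemma algebraMap_reducedTrace (hι : Fintype.card ι = degree F A) (ψ : A →ₐ[F] Matrix ι ι E)
    (a : A) : algebraMap F E (reducedTrace F A a) = (ψ a).trace := by
  have hn := degree_pos F A
  have : Nonempty ι := Fintype.card_pos_iff.1 (hι ▸ hn)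
  change algebraMap F E (redCoeff F A 1 a) = _
  rw [redCoeff, if_pos (Nat.succ_le_of_lt hn), Matrix.trace_eq_neg_charpoly_coeff,
    ← map_reducedCharpoly_algHom hι ψ, Polynomial.coeff_map, hι]
  simp

lemma algebraMap_t2Form (hι : Fintype.card ι = degree F A) (ψ : A →ₐ[F] Matrix ι ι E)
    (a : A) : algebraMap F E (t2Form F A a) = sumMinorsTwo (ψ a) := by
  change algebraMap F E (redCoeff F A 2 a) = _
  by_cases h : 2 ≤ degree F A
  · rw [redCoeff, if_pos h, map_mul, ← Polynomial.coeff_map, map_reducedCharpoly_algHom hι ψ, ← hι,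
      Matrix.charpoly_coeff_eq_sum_minors _ _ (hι ▸ h), sumMinorsTwo]
    simp
  · rw [redCoeff, if_neg h, sumMinorsTwo, Finset.powersetCard_eq_empty.2]
    · simp
    · rw [Finset.card_univ, hι]
      omega

end Representation

variable (F A) in
-- The spanning property transfers nondegeneracy of the matrix trace form to the reduced trace form.
lemma exists_representation : ∃ ψ : A →ₐ[F]
    Matrix (Fin (degree F A)) (Fin (degree F A)) (SeparableClosure F),
    Submodule.span (SeparableClosure F) (Set.range ψ) = ⊤ := by
  obtain ⟨φ⟩ := exists_splitting F A
  refine ⟨(φ.toAlgHom.restrictScalars F).comp Algebra.TensorProduct.includeRight, ?_⟩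
  rw [eq_top_iff]
  intro M _
  obtain ⟨x, rfl⟩ := φ.surjective M
  induction x using TensorProduct.induction_on with
  | zero => simp
  | tmul e a =>
    have : e ⊗ₜ[F] a = e • ((1 : SeparableClosure F) ⊗ₜ[F] a) := by
      simp [TensorProduct.smul_tmul']
    rw [this, map_smul]
    exact Submodule.smul_mem _ _ (Submodule.subset_span ⟨a, rfl⟩)
  | add x y hx hy =>
    rw [map_add]
    exact Submodule.add_mem _ (hx trivial) (hy trivial)

lemma reducedTrace_one : reducedTrace F A 1 = degree F A := by
  obtain ⟨ψ, -⟩ := exists_representation F A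
  apply (algebraMap F (SeparableClosure F)).injective
  rw [algebraMap_reducedTrace (by simp) ψ]
  simp

lemma t2Form_one : t2Form F A 1 = ((degree F A).choose 2 : ℕ) := by
  obtain ⟨ψ, -⟩ := exists_representation F A
  apply (algebraMap F (SeparableClosure F)).injective
  rw [algebraMap_t2Form (by simp) ψ, map_one, sumMinorsTwo_one]
  simp

lemma polar_t2Form (a b : A) :
    QuadraticMap.polar (t2Form F A) a b =
      reducedTrace F A a * reducedTrace F A b - reducedTrace F A (a * b) := by
  obtain ⟨ψ, -⟩ := exists_representation F A
  apply (algebraMap F (SeparableClosure F)).injective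
  simp only [QuadraticMap.polar, map_sub, map_mul, algebraMap_reducedTrace (Fintype.card_fin _) ψ,
    algebraMap_t2Form (Fintype.card_fin _) ψ, map_add, sumMinorsTwo_add]
  ring

lemma eq_zero_of_reducedTrace_mul_eq_zero (a : A) (h : ∀ b, reducedTrace F A (a * b) = 0) :
    a = 0 := by
  obtain ⟨ψ, hψ⟩ := exists_representation F A
  have : Nonempty (Fin (degree F A)) := ⟨⟨0, degree_pos F A⟩⟩
  apply RingHom.injective (ψ : A →+* Matrix (Fin (degree F A)) (Fin (degree F A)) (SeparableClosure F))
  rw [map_zero]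
  change ψ a = 0
  rw [Matrix.ext_iff_trace_mul_right]
  intro M
  have hM : M ∈ Submodule.span (SeparableClosure F) (Set.range ψ) := hψ ▸ Submodule.mem_top
  rw [zero_mul, Matrix.trace_zero]
  induction hM using Submodule.span_induction with
  | mem x hx =>
    obtain ⟨b, rfl⟩ := hx
    rw [← map_mul, ← algebraMap_reducedTrace (by simp) ψ, h, map_zero]
  | zero => simp
  | add x y _ _ hx hy => rw [mul_add, Matrix.trace_add, hx, hy, add_zero]
  | smul c x _ hx => rw [mul_smul_comm, Matrix.trace_smul, hx, smul_zero]

/-- The polar of `t₂` at `(a, a)` is `2 t₂(a) = 0`. This makes the trace form alternating on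
trace-zero elements. -/
lemma reducedTrace_mul_self [CharP F 2] (a : A) :
    reducedTrace F A (a * a) = reducedTrace F A a ^ 2 := by
  have h := polar_t2Form (F := F) a a
  rw [QuadraticMap.polar_self, two_smul, CharTwo.add_self_eq_zero] at h
  linear_combination h

section TensorProduct

variable {B : Type*} [Ring B] [Algebra F B] [Algebra.IsCentral F B] [IsSimpleRing B]
  [FiniteDimensional F B]

open scoped Kronecker in
variable (F A B) in
lemma exists_representation_tensorProduct :
    ∃ (ψ₁ : A →ₐ[F] Matrix (Fin (degree F A)) (Fin (degree F A)) (SeparableClosure F))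
      (ψ₂ : B →ₐ[F] Matrix (Fin (degree F B)) (Fin (degree F B)) (SeparableClosure F))
      (ψ : A ⊗[F] B →ₐ[F] Matrix (Fin (degree F A) × Fin (degree F B))
        (Fin (degree F A) × Fin (degree F B)) (SeparableClosure F)),
      ∀ a b, ψ (a ⊗ₜ b) = ψ₁ a ⊗ₖ ψ₂ b := by
  obtain ⟨ψ₁, -⟩ := exists_representation F A
  obtain ⟨ψ₂, -⟩ := exists_representation F B
  let E := SeparableClosure F
  let k := (Matrix.kroneckerAlgEquiv (Fin (degree F A)) (Fin (degree F B)) E).toAlgHom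
  let f₁ : A →ₐ[F] _ := ((k.comp Algebra.TensorProduct.includeLeft).restrictScalars F).comp ψ₁
  let f₂ : B →ₐ[F] _ := ((k.comp Algebra.TensorProduct.includeRight).restrictScalars F).comp ψ₂
  have hf : ∀ a b, f₁ a * f₂ b = ψ₁ a ⊗ₖ ψ₂ b := fun a b => by
    simp only [f₁, f₂, k, AlgHom.comp_apply, AlgHom.restrictScalars_apply,
      Algebra.TensorProduct.includeLeft_apply, Algebra.TensorProduct.includeRight_apply,
      ← map_mul, Algebra.TensorProduct.tmul_mul_tmul, one_mul, mul_one]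
    simp
    rfl
  have hcomm : ∀ a b, Commute (f₁ a) (f₂ b) := fun a b => by
    simp [f₁, f₂, k, commute_iff_eq, ← Matrix.mul_kronecker_mul]
  exact ⟨ψ₁, ψ₂, Algebra.TensorProduct.lift f₁ f₂ hcomm, fun a b =>
    (Algebra.TensorProduct.lift_tmul f₁ f₂ hcomm a b).trans (hf a b)⟩

lemma reducedTrace_tmul (a : A) (b : B) :
    reducedTrace F (A ⊗[F] B) (a ⊗ₜ b) = reducedTrace F A a * reducedTrace F B b := by
  obtain ⟨ψ₁, ψ₂, ψ, h⟩ := exists_representation_tensorProduct F A B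
  apply (algebraMap F (SeparableClosure F)).injective
  rw [map_mul, algebraMap_reducedTrace (by simp) ψ₁, algebraMap_reducedTrace (by simp) ψ₂,
    algebraMap_reducedTrace (by simp [degree_tensorProduct]) ψ, h, Matrix.trace_kronecker]

/-- The Kronecker formula, whose last term has a factor 2 and drops out. -/
lemma t2Form_tmul [CharP F 2] (a : A) (b : B) :
    t2Form F (A ⊗[F] B) (a ⊗ₜ b) =
      reducedTrace F A a ^ 2 * t2Form F B b + t2Form F A a * reducedTrace F B b ^ 2 := by
  obtain ⟨ψ₁, ψ₂, ψ, h⟩ := exists_representation_tensorProduct F A B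
  have h2 : (2 : SeparableClosure F) = 0 := by
    rw [← map_ofNat (algebraMap F (SeparableClosure F)) 2, CharTwo.two_eq_zero, map_zero]
  apply (algebraMap F (SeparableClosure F)).injective
  simp only [map_add, map_mul, map_pow, algebraMap_reducedTrace (Fintype.card_fin _) ψ₁,
    algebraMap_reducedTrace (Fintype.card_fin _) ψ₂, algebraMap_t2Form (Fintype.card_fin _) ψ₁,
    algebraMap_t2Form (Fintype.card_fin _) ψ₂]
  rw [algebraMap_t2Form (by simp [degree_tensorProduct]) ψ, h, sumMinorsTwo_kronecker, h2, zero_mul,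
    sub_zero]

end TensorProduct

end TraceForms

/-! ### Splitting off hyperbolic planes. -/

section Hyperbolic

variable {F : Type*} [Field F]

lemma binaryForm_apply (a b : F) (p : F × F) :
    binaryForm F a b p = a * (p.1 * p.1) + p.1 * p.2 + b * (p.2 * p.2) := by
  simp [binaryForm]

lemma hyperbolic_apply (m : ℕ) (x : Fin m → F × F) :
    hyperbolic F m x = ∑ i, (x i).1 * (x i).2 := by
  simp [hyperbolic, QuadraticMap.pi_apply, binaryForm_apply]

lemma exists_isometry_hyperbolic {W : Type*} [AddCommGroup W] [Module F W] [FiniteDimensional F W] :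
    ∃ h : (Fin (Module.finrank F W) → F × F) →ₗ[F] W × Module.Dual F W, Function.Injective h ∧
      ∀ x, (h x).2 (h x).1 = hyperbolic F _ x := by
  let b := Module.finBasis F W
  let h₁ : (Fin (Module.finrank F W) → F × F) →ₗ[F] W :=
    b.equivFun.symm.toLinearMap ∘ₗ (LinearMap.fst F F F).compLeft _
  let h₂ : (Fin (Module.finrank F W) → F × F) →ₗ[F] Module.Dual F W :=
    b.dualBasis.equivFun.symm.toLinearMap ∘ₗ (LinearMap.snd F F F).compLeft _
  refine ⟨h₁.prod h₂, ?_, fun x => ?_⟩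
  · rw [injective_iff_map_eq_zero]
    intro x hx
    have hx1 : (LinearMap.fst F F F).compLeft _ x = 0 :=
      b.equivFun.symm.injective (by simpa [h₁] using congrArg Prod.fst hx)
    have hx2 : (LinearMap.snd F F F).compLeft _ x = 0 :=
      b.dualBasis.equivFun.symm.injective (by simpa [h₂] using congrArg Prod.snd hx)
    ext i
    · exact congrFun hx1 i
    · exact congrFun hx2 i
  · rw [hyperbolic_apply]
    simp [h₁, h₂, Module.Basis.equivFun_symm_apply, Finsupp.single_apply]

/-- A nondegenerate quadratic space containing an orthogonal sum of a quadratic space `U` with a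
totally singular space `W` is, if its dimension is `dim U + 2 dim W`, the orthogonal sum of `U` and
a hyperbolic space. -/
theorem equivalent_prod_hyperbolic {V U W : Type*} [AddCommGroup V] [Module F V]
    [FiniteDimensional F V] [AddCommGroup U] [Module F U] [FiniteDimensional F U] [AddCommGroup W]
    [Module F W] [FiniteDimensional F W] (q : QuadraticForm F V) (Q : QuadraticForm F U)
    (k : U × W →ₗ[F] V) (hk : Function.Injective k) (hq : ∀ p, q (k p) = Q p.1)
    (hnd : ∀ x, (∀ y, QuadraticMap.polar q x y = 0) → x = 0) {m : ℕ}
    (hV : Module.finrank F V = Module.finrank F U + 2 * m) (hW : m ≤ Module.finrank F W) :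
    q.Equivalent (Q.prod (hyperbolic F m)) := by
  have hpolar : Function.Surjective q.polarBilin := by
    refine (LinearMap.injective_iff_surjective_of_finrank_eq_finrank
      (Subspace.dual_finrank_eq (K := F) (V := V)).symm).1 ?_
    rw [injective_iff_map_eq_zero]
    intro x hx
    exact hnd x fun y => by rw [← QuadraticMap.polarBilin_apply_apply, hx, LinearMap.zero_apply]
  have hg : Function.Surjective (k.dualMap ∘ₗ q.polarBilin) :=
    (LinearMap.dualMap_surjective_of_injective hk).comp hpolar
  -- Nondegeneracy realizes every functional on `U × W` by a vector of `V`; a linear choice `s`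
  -- embeds `W*` orthogonally to `U` and dual to `W`.
  obtain ⟨r, hr⟩ := LinearMap.exists_rightInverse_of_surjective _ (LinearMap.range_eq_top.2 hg)
  let s : Module.Dual F W →ₗ[F] V := r ∘ₗ (LinearMap.snd F U W).dualMap
  have hs : ∀ f p, QuadraticMap.polar q (s f) (k p) = f p.2 := fun f p =>
    LinearMap.congr_fun (LinearMap.congr_fun hr ((LinearMap.snd F U W).dualMap f)) p
  -- A possibly nonsymmetric bilinear form with diagonal `q ∘ s` exists in every characteristic.
  -- Read as a map `φ : W* → W`, it corrects `s f` to the singular vector `s f - φ f`.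
  obtain ⟨C, hC⟩ := LinearMap.BilinMap.toQuadraticMap_surjective (q.comp s)
  let φ : Module.Dual F W →ₗ[F] W := (Module.evalEquiv F W).symm.toLinearMap ∘ₗ C
  have hφ : ∀ f, f (φ f) = q (s f) := fun f => by
    have h1 : Module.evalEquiv F W (φ f) = C f := LinearEquiv.apply_symm_apply _ _
    have h2 := LinearMap.congr_fun h1 f
    rw [Module.evalEquiv_apply, Module.Dual.eval_apply] at h2
    rw [h2, ← QuadraticMap.comp_apply, ← hC, LinearMap.BilinMap.toQuadraticMap_apply]
  let T : U × (W × Module.Dual F W) →ₗ[F] V :=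
    k ∘ₗ (LinearMap.fst F _ _).prod ((LinearMap.fst F _ _ - φ ∘ₗ LinearMap.snd F _ _) ∘ₗ
      LinearMap.snd F _ _) + s ∘ₗ LinearMap.snd F _ _ ∘ₗ LinearMap.snd F _ _
  have hT : ∀ u w f, T (u, w, f) = k (u, w - φ f) + s f := fun u w f => rfl
  have hTq : ∀ u w f, q (T (u, w, f)) = Q u + f w := fun u w f => by
    rw [hT, QuadraticMap.map_add q, hq, ← hφ, QuadraticMap.polar_comm, hs]
    simp
  have hTinj : Function.Injective T := by
    rw [injective_iff_map_eq_zero]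
    rintro ⟨u, w, f⟩ h0
    rw [hT] at h0
    have hf : f = 0 := by
      ext w'
      have h1 : QuadraticMap.polar q (k (u, w - φ f)) (k (0, w')) = 0 := by
        rw [QuadraticMap.polar, ← map_add, hq, hq, hq]
        simp
      have h2 := QuadraticMap.polar_add_left q (k (u, w - φ f)) (s f) (k (0, w'))
      rw [h0, h1, hs, QuadraticMap.polar_zero_left, zero_add] at h2
      exact h2.symm
    subst hf
    rw [map_zero, map_zero, add_zero, sub_zero] at h0
    have := hk (h0.trans (map_zero k).symm)
    rw [Prod.mk_eq_zero] at this
    rw [this.1, this.2]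
    rfl
  have hle := LinearMap.finrank_le_finrank_of_injective hTinj
  rw [Module.finrank_prod, Module.finrank_prod, Subspace.dual_finrank_eq] at hle
  -- Injectivity of `T` bounds `dim W` above by `m`, so the assumed inequality is an equality.
  obtain rfl : m = Module.finrank F W := by omega
  obtain ⟨h, hh, hhq⟩ := exists_isometry_hyperbolic (F := F) (W := W)
  let T' : U × (Fin (Module.finrank F W) → F × F) →ₗ[F] V := T ∘ₗ LinearMap.id.prodMap h
  have hT'inj : Function.Injective T' :=
    hTinj.comp (Prod.map_injective.2 ⟨Function.injective_id, hh⟩)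
  have hdim : Module.finrank F (U × (Fin (Module.finrank F W) → F × F)) = Module.finrank F V := by
    rw [hV, Module.finrank_prod, Module.finrank_pi_fintype]
    simp
    ring
  refine ⟨QuadraticMap.IsometryEquiv.symm
    { T'.linearEquivOfInjective hT'inj hdim with
      map_app' := ?_ }⟩
  rintro ⟨u, x⟩
  change q (T (u, (h x).1, (h x).2)) = _
  rw [hTq, hhq, QuadraticMap.prod_apply]

end Hyperbolic

/-! ### Isotropic subspaces of alternating forms. -/

section Isotropic

/-- An alternating bilinear form has a totally isotropic subspace of at least half the dimension. -/
lemma exists_isotropic_submodule {F V : Type*} [Field F] [AddCommGroup V] [Module F V]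
    [FiniteDimensional F V] (B : LinearMap.BilinForm F V) (hB : B.IsAlt) :
    ∃ L : Submodule F V, (∀ x ∈ L, ∀ y ∈ L, B x y = 0) ∧
      Module.finrank F V ≤ 2 * Module.finrank F L := by
  obtain ⟨L, -, hL⟩ := exists_maximal_ge_of_wellFoundedGT
    (fun L : Submodule F V => ∀ x ∈ L, ∀ y ∈ L, B x y = 0) ⊥ (by simp)
  refine ⟨L, hL.1, ?_⟩
  -- A vector orthogonal to `L` is itself isotropic, so it can be adjoined to `L`; maximality puts
  -- it in `L`.
  have hle : B.orthogonal L ≤ L := fun x hx => by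
    rw [LinearMap.BilinForm.mem_orthogonal_iff] at hx
    have hx' : ∀ y ∈ L, B x y = 0 := fun y hy => hB.isRefl _ _ (hx y hy)
    refine hL.2 (y := L ⊔ Submodule.span F {x}) ?_ le_sup_left
      (Submodule.mem_sup_right (Submodule.mem_span_singleton_self x))
    intro y hy z hz
    obtain ⟨y', hy₀, _, hy', rfl⟩ := Submodule.mem_sup.1 hy
    obtain ⟨z', hz₀, _, hz', rfl⟩ := Submodule.mem_sup.1 hz
    obtain ⟨c, rfl⟩ := Submodule.mem_span_singleton.1 hy'
    obtain ⟨d, rfl⟩ := Submodule.mem_span_singleton.1 hz'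
    have h1 : B y' x = 0 := hx y' hy₀
    simp [hL.1 y' hy₀ z' hz₀, hx' z' hz₀, h1, hB.self_eq_zero x]
  have h := LinearMap.BilinForm.finrank_add_finrank_orthogonal hB.isRefl L
  have := Submodule.finrank_mono hle
  omega

end Isotropic

/-! ### Elementary isometries and binomial parities. -/

section Isometries

variable {F : Type*} [Field F]

lemma cast_choose_two [CharP F 2] (n : ℕ) :
    ((n.choose 2 : ℕ) : F) = if n % 4 < 2 then 0 else 1 := by
  have hn := Nat.div_add_mod n 4
  set k := n / 4
  have hr : n % 4 < 4 := Nat.mod_lt _ (by norm_num)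
  have key : n.choose 2 % 2 = if n % 4 < 2 then 0 else 1 := by
    rw [Nat.choose_two_right]
    interval_cases h : n % 4 <;> rw [← hn]
    · rw [show (4 * k + 0) * (4 * k + 0 - 1) = 2 * (2 * (k * (4 * k + 0 - 1))) by ring]
      simp
    · rw [show (4 * k + 1) * (4 * k + 1 - 1) = 2 * (2 * ((4 * k + 1) * k)) by
        rw [Nat.add_sub_cancel]; ring]
      simp
    · rw [show (4 * k + 2) * (4 * k + 2 - 1) = 2 * (2 * (k * (4 * k + 3)) + 1) by
        rw [show 4 * k + 2 - 1 = 4 * k + 1 from rfl]; ring]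
      simp
    · rw [show (4 * k + 3) * (4 * k + 3 - 1) = 2 * (2 * (k * (4 * k + 5) + 1) + 1) by
        rw [show 4 * k + 3 - 1 = 4 * k + 2 from rfl]; ring]
      simp
  rw [← Nat.div_add_mod (n.choose 2) 2, key]
  split_ifs <;> simp [CharTwo.two_eq_zero]

lemma hyperbolic_succ_equivalent (m : ℕ) :
    (hyperbolic F (m + 1)).Equivalent ((binaryForm F 0 0).prod (hyperbolic F m)) := by
  refine ⟨QuadraticMap.IsometryEquiv.symm
    { Fin.consLinearEquiv F (fun _ : Fin (m + 1) => F × F) with map_app' := ?_ }⟩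
  rintro ⟨p, x⟩
  change hyperbolic F (m + 1) (Fin.cons p x : Fin (m + 1) → F × F) = _
  rw [hyperbolic_apply, Fin.sum_univ_succ, QuadraticMap.prod_apply, hyperbolic_apply,
    binaryForm_apply]
  simp

lemma binaryForm_zero_right_equivalent (a : F) :
    (binaryForm F a 0).Equivalent (binaryForm F 0 0) := by
  let e : (F × F) ≃ₗ[F] F × F := LinearEquiv.ofLinearMap
        ((LinearMap.fst F F F).prod (a • LinearMap.fst F F F + LinearMap.snd F F F))
        ((LinearMap.fst F F F).prod (LinearMap.snd F F F - a • LinearMap.fst F F F))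
        (by ext <;> simp) (by ext <;> simp)
  refine ⟨{ e with map_app' := ?_ }⟩
  rintro ⟨x, y⟩
  simp [e, binaryForm_apply]
  ring

lemma binaryForm_zero_left_equivalent (b : F) :
    (binaryForm F 0 b).Equivalent (binaryForm F 0 0) := by
  let e : (F × F) ≃ₗ[F] F × F := LinearEquiv.ofLinearMap
        ((LinearMap.fst F F F + b • LinearMap.snd F F F).prod (LinearMap.snd F F F))
        ((LinearMap.fst F F F - b • LinearMap.snd F F F).prod (LinearMap.snd F F F))
        (by ext <;> simp) (by ext <;> simp)
  refine ⟨{ e with map_app' := ?_ }⟩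
  rintro ⟨x, y⟩
  simp [e, binaryForm_apply]
  ring

lemma prod_assoc_equivalent {U V W : Type*} [AddCommGroup U] [Module F U] [AddCommGroup V]
    [Module F V] [AddCommGroup W] [Module F W] (p : QuadraticForm F U) (q : QuadraticForm F V)
    (r : QuadraticForm F W) : ((p.prod q).prod r).Equivalent (p.prod (q.prod r)) :=
  ⟨{ LinearEquiv.prodAssoc F U V W with
      map_app' := fun ⟨⟨u, v⟩, w⟩ => by
        simp [add_assoc] }⟩

end Isometries

/-! ### Modifying a form by the square of a polar functional. -/

section Twist

variable {F V : Type*} [Field F] [CharP F 2] [AddCommGroup V] [Module F V]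

/-- Adding the square of `polar q · v` to `q` does not change the isometry class, if `q v = 0`. -/
lemma equivalent_of_add_sq_polar {q q' : QuadraticForm F V} (v : V) (hv : q v = 0)
    (hq' : ∀ x, q' x = q x + QuadraticMap.polar q x v ^ 2) : q'.Equivalent q := by
  -- As `q v = 0`, the cross term in `q (T x)` contributes exactly `polar q x v ^ 2`.
  let T : V →ₗ[F] V := LinearMap.id + (q.polarBilin.flip v).smulRight v
  have hT : ∀ x, T x = x + QuadraticMap.polar q x v • v := fun x => rfl
  have hinv : Function.Involutive T := fun x => by
    rw [hT (T x), hT x, QuadraticMap.polar_add_left, QuadraticMap.polar_smul_left,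
      QuadraticMap.polar_self, hv, smul_zero, smul_zero, add_zero, add_assoc, ← add_smul,
      CharTwo.add_self_eq_zero, zero_smul, add_zero]
  refine ⟨{ LinearEquiv.ofInvolutive T hinv with map_app' := fun x => ?_ }⟩
  change q (T x) = _
  rw [hT, QuadraticMap.map_add q, QuadraticMap.map_smul, hv, smul_zero, add_zero,
    QuadraticMap.polar_smul_right, hq', smul_eq_mul, sq]

/-- Adding the square of `polar q · v` to `q`, if `q v = 1`. -/
lemma prod_equivalent_of_add_sq_polar {q q' : QuadraticForm F V} (v : V) (hv : q v = 1)
    (hq' : ∀ x, q' x = q x + QuadraticMap.polar q x v ^ 2) :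
    (q'.prod (binaryForm F 0 0)).Equivalent ((binaryForm F 1 1).prod q) := by
  let β : V →ₗ[F] F := q.polarBilin.flip v
  have hβ : ∀ x, β x = QuadraticMap.polar q x v := fun x => rfl
  have h2 : (2 : F) = 0 := CharTwo.two_eq_zero
  have hβv : β v = 0 := by
    rw [hβ, QuadraticMap.polar_self, hv, two_smul, CharTwo.add_self_eq_zero]
  -- Let `e₁, e₂` be the standard basis of `[1,1]`. Since `e₂` has value 1, `x ↦ x + β(x)e₂` embeds
  -- `q'` isometrically; `e₁ + v` and `e₁ + e₂ + v` form a hyperbolic pair orthogonal to its image.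
  let T : V × (F × F) →ₗ[F] (F × F) × V :=
    { toFun := fun p => ((p.2.1 + p.2.2, β p.1 + p.2.2), p.1 + (p.2.1 + p.2.2) • v)
      map_add' := fun p p' => by
        ext <;> simp <;> first | ring1 | module
      map_smul' := fun c p => by
        ext <;> simp <;> first | ring1 | module }
  let S : (F × F) × V → V × (F × F) := fun p =>
    (p.2 + p.1.1 • v, (p.1.1 + (p.1.2 + β p.2), p.1.2 + β p.2))
  have hST : Function.LeftInverse S T := fun ⟨x, s, t⟩ => by
    have h1 : s + t + (s + t) = 0 := CharTwo.add_self_eq_zero _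
    have h3 : β x + t + β x = t := by linear_combination β x * h2
    have h4 : s + t + t = s := by linear_combination t * h2
    simp [S, T, hβv, add_assoc x, ← add_smul, h1, h3, h4]
  have hTS : Function.RightInverse S T := fun ⟨⟨a, b⟩, x⟩ => by
    have h1 : a + (b + β x) + (b + β x) = a := by linear_combination (b + β x) * h2
    have h3 : a + a = 0 := CharTwo.add_self_eq_zero _
    have h4 : β x + (b + β x) = b := by linear_combination β x * h2
    simp [S, T, hβv, h1, add_assoc x, ← add_smul, h3, h4]
  refine ⟨{ toLinearEquiv := { T with invFun := S, left_inv := hST, right_inv := hTS },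
            map_app' := ?_ }⟩
  rintro ⟨x, s, t⟩
  change ((binaryForm F 1 1).prod q) ((s + t, β x + t), x + (s + t) • v) = _
  rw [QuadraticMap.prod_apply, QuadraticMap.prod_apply, binaryForm_apply, binaryForm_apply,
    QuadraticMap.map_add q, QuadraticMap.map_smul, hv, QuadraticMap.polar_smul_right, hq', ← hβ]
  simp only [smul_eq_mul]
  linear_combination ((s + t) * (s + t) + (s + t) * β x + t * t + β x * t) * h2

end Twist

lemma secondTraceForm_equivalent_t2Form (F A : Type*) [Field F] [Ring A] [Algebra F A]
    (hn : Even (degree F A)) :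
    (secondTraceForm F A).Equivalent (t2Form F A) :=
  ⟨{ LinearEquiv.ofTop (traceSpace F A) (if_pos hn) with map_app' := fun _ => rfl }⟩

lemma traceSpace_of_odd {F A : Type*} [Field F] [Ring A] [Algebra F A] (hn : Odd (degree F A)) :
    traceSpace F A = LinearMap.ker (reducedTrace F A) := if_neg (Nat.not_even_iff_odd.2 hn)

/-! ### Partial traces, used to prove sums in the tensor product direct. -/

section Contraction

variable {F A B : Type*} [Field F] [Ring A] [Algebra F A] [Ring B] [Algebra F B]

/-- The contraction of the second factor with a linear form. -/
def contractRight (f : Module.Dual F B) : A ⊗[F] B →ₗ[F] A :=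
  (TensorProduct.rid F A).toLinearMap ∘ₗ f.lTensor A

lemma contractRight_tmul (f : Module.Dual F B) (a : A) (b : B) :
    contractRight f (a ⊗ₜ[F] b) = f b • a := by
  simp [contractRight]

/-- The contraction of the first factor with a linear form. -/
def contractLeft (f : Module.Dual F A) : A ⊗[F] B →ₗ[F] B :=
  (TensorProduct.lid F B).toLinearMap ∘ₗ f.rTensor B

lemma contractLeft_tmul (f : Module.Dual F A) (a : A) (b : B) :
    contractLeft f (a ⊗ₜ[F] b) = f a • b := by
  simp [contractLeft]

lemma contractRight_mapIncl_mem (f : Module.Dual F B) (L : Submodule F A)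
    (M : Submodule F B) (w : L ⊗[F] M) :
    contractRight f (TensorProduct.mapIncl L M w) ∈ L := by
  induction w using TensorProduct.induction_on with
  | zero => rw [map_zero, map_zero]; exact zero_mem _
  | tmul x y =>
    rw [TensorProduct.mapIncl, TensorProduct.map_tmul, contractRight_tmul]
    exact L.smul_mem _ x.2
  | add v w hv hw => rw [map_add, map_add]; exact add_mem hv hw

lemma contractRight_mapIncl_ker {L : Submodule F A}
    (w : L ⊗[F] LinearMap.ker (reducedTrace F B)) :
    contractRight (reducedTrace F B) (TensorProduct.mapIncl L _ w) = 0 := by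
  induction w using TensorProduct.induction_on with
  | zero => rw [map_zero, map_zero]
  | tmul x y =>
    rw [TensorProduct.mapIncl, TensorProduct.map_tmul, contractRight_tmul, Submodule.subtype_apply,
      Submodule.subtype_apply, LinearMap.mem_ker.1 y.2, zero_smul]
  | add v w hv hw => rw [map_add, map_add, hv, hw, add_zero]

lemma contractLeft_mapIncl {L : Submodule F A} (hL : L ≤ LinearMap.ker (reducedTrace F A))
    (M : Submodule F B) (w : L ⊗[F] M) :
    contractLeft (reducedTrace F A) (TensorProduct.mapIncl L M w) = 0 := by
  induction w using TensorProduct.induction_on with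
  | zero => rw [map_zero, map_zero]
  | tmul x y =>
    rw [TensorProduct.mapIncl, TensorProduct.map_tmul, contractLeft_tmul, Submodule.subtype_apply,
      Submodule.subtype_apply, LinearMap.mem_ker.1 (hL x.2), zero_smul]
  | add v w hv hw => rw [map_add, map_add, hv, hw, add_zero]

lemma mapIncl_injective (L : Submodule F A) (M : Submodule F B) :
    Function.Injective (TensorProduct.mapIncl L M) :=
  TensorProduct.map_injective_of_flat_flat _ _ L.injective_subtype M.injective_subtype

end Contraction

/-! ### Nondegeneracy of the second trace form and the isotropic subspace of `A₀`. -/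

section TraceSpace

variable {F A : Type*} [Field F] [Ring A] [Algebra F A] [Algebra.IsCentral F A]
  [IsSimpleRing A] [FiniteDimensional F A]

lemma polar_t2Form_one_right [CharP F 2] (hn : Even (degree F A)) (a : A) :
    QuadraticMap.polar (t2Form F A) a 1 = reducedTrace F A a := by
  rw [polar_t2Form, reducedTrace_one, CharTwo.natCast_eq_ite (R := F), if_pos hn, mul_zero,
    mul_one, zero_sub, CharTwo.neg_eq]

/-- Pairing with 1 first gives `t₁(a) = 0`; the polar form then reduces to the nondegenerate trace
form. -/
lemma eq_zero_of_polar_t2Form [CharP F 2] (hn : Even (degree F A)) (a : A)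
    (h : ∀ b, QuadraticMap.polar (t2Form F A) a b = 0) : a = 0 := by
  have h1 := h 1
  rw [polar_t2Form_one_right hn] at h1
  refine eq_zero_of_reducedTrace_mul_eq_zero (F := F) a fun b => ?_
  have := h b
  rw [polar_t2Form, h1] at this
  linear_combination -this

lemma exists_reducedTrace_eq_one : ∃ a : A, reducedTrace F A a = 1 := by
  have hne : ∃ a : A, reducedTrace F A a ≠ 0 := by
    by_contra! h
    exact one_ne_zero (eq_zero_of_reducedTrace_mul_eq_zero (F := F) (1 : A) fun b => h _)
  obtain ⟨a, ha⟩ := hne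
  exact ⟨(reducedTrace F A a)⁻¹ • a, by rw [map_smul, smul_eq_mul, inv_mul_cancel₀ ha]⟩

variable (F A) in
lemma finrank_ker_reducedTrace :
    Module.finrank F (LinearMap.ker (reducedTrace F A)) + 1 = degree F A ^ 2 := by
  rw [← finrank_eq_degree_sq]
  apply Module.Dual.finrank_ker_add_one_of_ne_zero
  obtain ⟨a, ha⟩ := exists_reducedTrace_eq_one (F := F) (A := A)
  intro h
  rw [h] at ha
  simp at ha

variable (F A) in
/-- `A₀` contains a totally isotropic subspace for the trace form of half the dimension. -/
lemma exists_isotropic_le_ker_reducedTrace [CharP F 2] :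
    ∃ L : Submodule F A, L ≤ LinearMap.ker (reducedTrace F A) ∧
      (∀ x ∈ L, ∀ y ∈ L, reducedTrace F A (x * y) = 0) ∧
      degree F A ^ 2 ≤ 2 * Module.finrank F L + 1 := by
  let K := LinearMap.ker (reducedTrace F A)
  let B : LinearMap.BilinForm F K :=
    ((LinearMap.mul F A).compr₂ (reducedTrace F A)).domRestrict₁₂ K K
  have hB : ∀ x y : K, B x y = reducedTrace F A (x * y) := fun x y => rfl
  obtain ⟨L, hL, hd⟩ := exists_isotropic_submodule B fun x => by
    rw [hB, reducedTrace_mul_self, LinearMap.mem_ker.1 x.2, sq, mul_zero]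
  refine ⟨L.map K.subtype, Submodule.map_subtype_le K L, ?_, ?_⟩
  · rintro _ ⟨x, hx, rfl⟩ _ ⟨y, hy, rfl⟩
    exact hL x hx y hy
  · rw [Submodule.finrank_map_subtype_eq, ← finrank_ker_reducedTrace]
    exact Nat.add_le_add_right hd 1

/-- In odd degree `t₁(1) = 1`, so `A = F·1 ⊕ A₀` is orthogonal for the trace form, which thus stays
nondegenerate on `A₀`. -/
lemma eq_zero_of_polar_secondTraceForm [CharP F 2] (hn : Odd (degree F A)) (x : traceSpace F A)
    (h : ∀ y, QuadraticMap.polar (secondTraceForm F A) x y = 0) : x = 0 := by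
  have hmem : ∀ a : A, a ∈ traceSpace F A ↔ reducedTrace F A a = 0 := fun a => by
    rw [traceSpace_of_odd hn, LinearMap.mem_ker]
  have h1 : reducedTrace F A 1 = 1 := by
    rw [reducedTrace_one, CharTwo.natCast_eq_ite (R := F), if_neg (Nat.not_even_iff_odd.2 hn)]
  have hx := (hmem x).1 x.2
  refine Subtype.ext (eq_zero_of_reducedTrace_mul_eq_zero (F := F) (x : A) fun b => ?_)
  have hb : b - reducedTrace F A b • 1 ∈ traceSpace F A := by
    rw [hmem, map_sub, map_smul, h1, smul_eq_mul, mul_one, sub_self]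
  have h2 : QuadraticMap.polar (t2Form F A) (x : A) (b - reducedTrace F A b • 1) = 0 := h ⟨_, hb⟩
  rw [polar_t2Form, hx, zero_mul, zero_sub, neg_eq_zero, mul_sub, map_sub, mul_smul_comm, map_smul,
    mul_one, hx, smul_zero, sub_zero] at h2
  exact h2

lemma t2Form_algEquiv {B : Type*} [Ring B] [Algebra F B] [Algebra.IsCentral F B]
    [IsSimpleRing B] [FiniteDimensional F B] (e : A ≃ₐ[F] B) (a : A) :
    t2Form F B (e a) = t2Form F A a := by
  have hd : degree F B = degree F A := by
    rw [degree, degree, e.toLinearEquiv.finrank_eq]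
  obtain ⟨ψ, -⟩ := exists_representation F B
  apply (algebraMap F (SeparableClosure F)).injective
  rw [algebraMap_t2Form (by simp) ψ, algebraMap_t2Form (by simp [hd]) (ψ.comp e.toAlgHom)]
  rfl

end TraceSpace

lemma finrank_tensorProduct_ker {F V B : Type*} [Field F] [AddCommGroup V] [Module F V]
    [Ring B] [Algebra F B] [Algebra.IsCentral F B] [IsSimpleRing B] [FiniteDimensional F B] :
    Module.finrank F (V ⊗[F] LinearMap.ker (reducedTrace F B)) =
      Module.finrank F V * (degree F B ^ 2 - 1) := by
  rw [Module.finrank_tensorProduct, ← finrank_ker_reducedTrace F B, Nat.add_sub_cancel]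

/-! ### The totally singular subspace `L ⊗ B₀`. -/

section TensorProduct

variable {F A B : Type*} [Field F] [Ring A] [Algebra F A] [Algebra.IsCentral F A]
  [IsSimpleRing A] [FiniteDimensional F A] [Ring B] [Algebra F B] [Algebra.IsCentral F B]
  [IsSimpleRing B] [FiniteDimensional F B]

lemma polar_t2Form_tmul (a a' : A) (b b' : B) :
    QuadraticMap.polar (t2Form F (A ⊗[F] B)) (a ⊗ₜ b) (a' ⊗ₜ b') =
      reducedTrace F A a * reducedTrace F B b * (reducedTrace F A a' * reducedTrace F B b') -
        reducedTrace F A (a * a') * reducedTrace F B (b * b') := by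
  rw [polar_t2Form, Algebra.TensorProduct.tmul_mul_tmul, reducedTrace_tmul, reducedTrace_tmul,
    reducedTrace_tmul]

lemma polar_t2Form_tmul_mapIncl {L : Submodule F A} {M : Submodule F B} (a : A) (b : B)
    (h : ∀ x ∈ L, ∀ y ∈ M, reducedTrace F A a * reducedTrace F B b *
      (reducedTrace F A x * reducedTrace F B y) -
        reducedTrace F A (a * x) * reducedTrace F B (b * y) = 0) (w : L ⊗[F] M) :
    QuadraticMap.polar (t2Form F (A ⊗[F] B)) (a ⊗ₜ b) (TensorProduct.mapIncl L M w) = 0 := by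
  induction w using TensorProduct.induction_on with
  | zero => rw [map_zero, QuadraticMap.polar_zero_right]
  | tmul x y =>
    rw [TensorProduct.mapIncl, TensorProduct.map_tmul, Submodule.subtype_apply,
      Submodule.subtype_apply, polar_t2Form_tmul]
    exact h x x.2 y y.2
  | add v w hv hw => rw [map_add, QuadraticMap.polar_add_right, hv, hw, add_zero]

/-- Pure tensors of trace-zero elements are singular, and their polar values are multiples of
`t₁(xx')`, which vanishes on `L`. -/
lemma t2Form_mapIncl [CharP F 2] {L : Submodule F A} (hL : L ≤ LinearMap.ker (reducedTrace F A))
    (hLL : ∀ x ∈ L, ∀ y ∈ L, reducedTrace F A (x * y) = 0)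
    (w : L ⊗[F] LinearMap.ker (reducedTrace F B)) :
    t2Form F (A ⊗[F] B) (TensorProduct.mapIncl L (LinearMap.ker (reducedTrace F B)) w) = 0 := by
  have hp : ∀ v w : L ⊗[F] LinearMap.ker (reducedTrace F B),
      QuadraticMap.polar (t2Form F (A ⊗[F] B)) (TensorProduct.mapIncl L _ v)
        (TensorProduct.mapIncl L _ w) = 0 := fun v w => by
    induction v using TensorProduct.induction_on with
    | zero => rw [map_zero, QuadraticMap.polar_zero_left]
    | tmul x y =>
      refine polar_t2Form_tmul_mapIncl _ _ (fun x' hx' y' hy' => ?_) w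
      have h1 := LinearMap.mem_ker.1 (hL hx')
      have h2 := hLL x x.2 x' hx'
      simp [h1, h2]
    | add u v hu hv => rw [map_add, QuadraticMap.polar_add_left, hu, hv, add_zero]
  induction w using TensorProduct.induction_on with
  | zero => rw [map_zero, QuadraticMap.map_zero]
  | tmul x y =>
    have h1 := LinearMap.mem_ker.1 (hL x.2)
    have h2 := LinearMap.mem_ker.1 y.2
    rw [TensorProduct.mapIncl, TensorProduct.map_tmul, Submodule.subtype_apply,
      Submodule.subtype_apply, t2Form_tmul, h1, h2]
    ring
  | add v w hv hw =>
    rw [map_add, QuadraticMap.map_add (t2Form F (A ⊗[F] B)), hv, hw, hp, add_zero, add_zero]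

lemma reducedTrace_mapIncl {L : Submodule F A} (hL : L ≤ LinearMap.ker (reducedTrace F A))
    (M : Submodule F B) (w : L ⊗[F] M) :
    reducedTrace F (A ⊗[F] B) (TensorProduct.mapIncl L M w) = 0 := by
  induction w using TensorProduct.induction_on with
  | zero => rw [map_zero, map_zero]
  | tmul x y =>
    rw [TensorProduct.mapIncl, TensorProduct.map_tmul, reducedTrace_tmul, Submodule.subtype_apply,
      Submodule.subtype_apply, LinearMap.mem_ker.1 (hL x.2), zero_mul]
  | add v w hv hw => rw [map_add, map_add, hv, hw, add_zero]

end TensorProduct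

lemma natCast_of_odd {F : Type*} [Field F] [CharP F 2] {n : ℕ} (hn : Odd n) : (n : F) = 1 := by
  rw [CharTwo.natCast_eq_ite (R := F), if_neg (Nat.not_even_iff_odd.2 hn)]

lemma natCast_of_even {F : Type*} [Field F] [CharP F 2] {n : ℕ} (hn : Even n) : (n : F) = 0 := by
  rw [CharTwo.natCast_eq_ite (R := F), if_pos hn]

lemma finrank_traceSpace_of_odd {F A : Type*} [Field F] [Ring A] [Algebra F A]
    [Algebra.IsCentral F A] [IsSimpleRing A] [FiniteDimensional F A] (hn : Odd (degree F A)) :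
    Module.finrank F (traceSpace F A) = degree F A ^ 2 - 1 := by
  rw [traceSpace_of_odd hn, ← finrank_ker_reducedTrace, Nat.add_sub_cancel]

lemma exists_disjoint_finrank_add_eq {F V : Type*} [Field F] [AddCommGroup V] [Module F V]
    [FiniteDimensional F V] {L K : Submodule F V} (h : L ≤ K) :
    ∃ C ≤ K, Disjoint L C ∧ Module.finrank F L + Module.finrank F C = Module.finrank F K := by
  obtain ⟨C, hC⟩ := L.exists_isCompl
  have hdis : Disjoint L (C ⊓ K) := hC.disjoint.mono_right inf_le_left
  refine ⟨C ⊓ K, inf_le_right, hdis, ?_⟩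
  rw [← Submodule.finrank_sup_add_finrank_inf_eq, hdis.eq_bot, finrank_bot, add_zero,
    ← sup_inf_assoc_of_le C h, hC.sup_eq_top, top_inf_eq]

/-! ### The three decompositions, by parity of the degrees. -/

section Decomposition

variable {F A B : Type*} [Field F] [CharP F 2] [Ring A] [Algebra F A] [Algebra.IsCentral F A]
  [IsSimpleRing A] [FiniteDimensional F A] [Ring B] [Algebra F B] [Algebra.IsCentral F B]
  [IsSimpleRing B] [FiniteDimensional F B]

theorem secondTraceForm_tensorProduct_odd_odd (hA : Odd (degree F A)) (hB : Odd (degree F B)) :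
    (secondTraceForm F (A ⊗[F] B)).Equivalent
      (((secondTraceForm F A).prod (secondTraceForm F B)).prod
        (hyperbolic F ((degree F A ^ 2 - 1) * (degree F B ^ 2 - 1) / 2))) := by
  obtain ⟨L, hL, hLL, hd⟩ := exists_isotropic_le_ker_reducedTrace F A
  have hAB : Odd (degree F (A ⊗[F] B)) := by
    rw [degree_tensorProduct]
    exact hA.mul hB
  have h1A : reducedTrace F A 1 = 1 := by rw [reducedTrace_one, natCast_of_odd hA]
  have h1B : reducedTrace F B 1 = 1 := by rw [reducedTrace_one, natCast_of_odd hB]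
  have hmA : ∀ a : traceSpace F A, reducedTrace F A a = 0 := fun a =>
    LinearMap.mem_ker.1 (traceSpace_of_odd hA ▸ a.2)
  have hmB : ∀ b : traceSpace F B, reducedTrace F B b = 0 := fun b =>
    LinearMap.mem_ker.1 (traceSpace_of_odd hB ▸ b.2)
  have hdvd : 2 ∣ (degree F A ^ 2 - 1) * (degree F B ^ 2 - 1) :=
    Dvd.dvd.mul_right (even_iff_two_dvd.1 (Nat.Odd.sub_odd hA.pow odd_one)) _
  let W := L ⊗[F] LinearMap.ker (reducedTrace F B)
  let ι : W →ₗ[F] A ⊗[F] B := TensorProduct.mapIncl L (LinearMap.ker (reducedTrace F B))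
  let k₀ : (traceSpace F A × traceSpace F B) × W →ₗ[F] A ⊗[F] B :=
    (((Algebra.TensorProduct.includeLeft (R := F) (S := F) (A := A) (B := B)).toLinearMap ∘ₗ
      (traceSpace F A).subtype).coprod
      ((Algebra.TensorProduct.includeRight (R := F) (A := A) (B := B)).toLinearMap ∘ₗ
        (traceSpace F B).subtype)).coprod ι
  have hk₀ : ∀ (a : traceSpace F A) (b : traceSpace F B) (w : W),
      k₀ ((a, b), w) = (a : A) ⊗ₜ 1 + 1 ⊗ₜ (b : B) + ι w := fun a b w => rfl
  have hk₀mem : ∀ p, k₀ p ∈ traceSpace F (A ⊗[F] B) := by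
    rintro ⟨⟨a, b⟩, w⟩
    rw [traceSpace_of_odd hAB, LinearMap.mem_ker, hk₀, map_add, map_add, reducedTrace_tmul,
      reducedTrace_tmul, reducedTrace_mapIncl hL, hmA, hmB]
    ring
  refine equivalent_prod_hyperbolic _ _ (k₀.codRestrict _ hk₀mem) ?_ ?_
    (fun x hx => eq_zero_of_polar_secondTraceForm hAB x hx) ?_ (W := W) ?_
  · refine Function.Injective.of_comp (f := Subtype.val) ?_
    change Function.Injective k₀
    rw [injective_iff_map_eq_zero]
    rintro ⟨⟨a, b⟩, w⟩ h0
    rw [hk₀] at h0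
    -- The partial traces kill `L ⊗ B₀` and isolate the two other components, because `t₁(1) = 1` on
    -- both sides.
    have ha := congrArg (contractRight (reducedTrace F B)) h0
    rw [map_add, map_add, contractRight_tmul, contractRight_tmul, contractRight_mapIncl_ker,
      hmB, h1B, map_zero, zero_smul, one_smul, add_zero, add_zero] at ha
    have hb := congrArg (contractLeft (reducedTrace F A)) h0
    rw [map_add, map_add, contractLeft_tmul, contractLeft_tmul, contractLeft_mapIncl hL,
      hmA, h1A, map_zero, zero_smul, one_smul, zero_add, add_zero] at hb
    rw [ha, hb, TensorProduct.zero_tmul, TensorProduct.tmul_zero, add_zero, zero_add] at h0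
    have hw : w = 0 := mapIncl_injective _ _ (h0.trans (map_zero _).symm)
    rw [hw, show a = 0 from Subtype.ext ha, show b = 0 from Subtype.ext hb]
    rfl
  · rintro ⟨⟨a, b⟩, w⟩
    change t2Form F (A ⊗[F] B) (k₀ ((a, b), w)) = t2Form F A a + t2Form F B b
    rw [hk₀, QuadraticMap.map_add (t2Form F (A ⊗[F] B)),
      QuadraticMap.map_add (t2Form F (A ⊗[F] B)), QuadraticMap.polar_add_left,
      polar_t2Form_tmul_mapIncl, polar_t2Form_tmul_mapIncl, t2Form_mapIncl hL hLL, t2Form_tmul,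
      t2Form_tmul, polar_t2Form_tmul, hmA, hmB, h1A, h1B, mul_one (a : A), one_mul (b : B), hmA, hmB]
    · ring
    · intro x hx y hy
      rw [hmB, one_mul x, LinearMap.mem_ker.1 (hL hx)]
      ring
    · intro x hx y hy
      rw [hmA, one_mul y, LinearMap.mem_ker.1 hy]
      ring
  · rw [Module.finrank_prod, finrank_traceSpace_of_odd hA, finrank_traceSpace_of_odd hB,
      finrank_traceSpace_of_odd hAB, degree_tensorProduct, Nat.mul_div_cancel' hdvd, mul_pow]
    have h1 := Nat.one_le_pow 2 _ (degree_pos F A)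
    have h2 := Nat.one_le_pow 2 _ (degree_pos F B)
    obtain ⟨p, hp⟩ := Nat.exists_eq_add_of_le' h1
    obtain ⟨q, hq⟩ := Nat.exists_eq_add_of_le' h2
    rw [hp, hq]
    simp only [Nat.add_sub_cancel]
    rw [show (p + 1) * (q + 1) = p + q + p * q + 1 by ring, Nat.add_sub_cancel]
  · rw [finrank_tensorProduct_ker]
    refine Nat.div_le_of_le_mul ?_
    rw [← mul_assoc]
    exact Nat.mul_le_mul_right _ (by omega)

/-- The restriction of `t₂` to `A ⊗ 1`. -/
def t2FormLeft (F A B : Type*) [Field F] [Ring A] [Algebra F A] [Ring B] [Algebra F B] :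
    QuadraticForm F A :=
  (t2Form F (A ⊗[F] B)).comp
    (Algebra.TensorProduct.includeLeft (R := F) (S := F) (A := A) (B := B)).toLinearMap

lemma t2FormLeft_apply (hB : Odd (degree F B)) (a : A) :
    t2FormLeft F A B a =
      t2Form F A a + reducedTrace F A a ^ 2 * ((degree F B).choose 2 : ℕ) := by
  change t2Form F (A ⊗[F] B) (a ⊗ₜ 1) = _
  rw [t2Form_tmul, t2Form_one, reducedTrace_one, natCast_of_odd hB]
  ring

theorem t2Form_tensorProduct_even_odd (hA : Even (degree F A)) (hB : Odd (degree F B)) :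
    (t2Form F (A ⊗[F] B)).Equivalent
      ((t2FormLeft F A B).prod (hyperbolic F (degree F A ^ 2 * (degree F B ^ 2 - 1) / 2))) := by
  obtain ⟨L, hL, hLL, hd⟩ := exists_isotropic_le_ker_reducedTrace F A
  have hAB : Even (degree F (A ⊗[F] B)) := by
    rw [degree_tensorProduct]
    exact hA.mul_right _
  have h1B : reducedTrace F B 1 = 1 := by rw [reducedTrace_one, natCast_of_odd hB]
  have hA2 : 2 ∣ degree F A ^ 2 := (even_iff_two_dvd.1 hA).trans (dvd_pow_self _ two_ne_zero)
  let W := L ⊗[F] LinearMap.ker (reducedTrace F B)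
  let ι : W →ₗ[F] A ⊗[F] B := TensorProduct.mapIncl L (LinearMap.ker (reducedTrace F B))
  let k : A × W →ₗ[F] A ⊗[F] B :=
    (Algebra.TensorProduct.includeLeft (R := F) (S := F) (A := A) (B := B)).toLinearMap.coprod ι
  have hk : ∀ (a : A) (w : W), k (a, w) = (a : A) ⊗ₜ 1 + ι w := fun a w => rfl
  refine equivalent_prod_hyperbolic _ _ k ?_ ?_ (fun x hx => eq_zero_of_polar_t2Form hAB x hx) ?_
    (W := W) ?_
  · rw [injective_iff_map_eq_zero]
    rintro ⟨a, w⟩ h0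
    rw [hk] at h0
    have ha := congrArg (contractRight (reducedTrace F B)) h0
    rw [map_add, contractRight_tmul, contractRight_mapIncl_ker, h1B, map_zero, one_smul,
      add_zero] at ha
    rw [ha, TensorProduct.zero_tmul, zero_add] at h0
    have hw : w = 0 := mapIncl_injective _ _ (h0.trans (map_zero _).symm)
    rw [hw, ha]
    rfl
  · rintro ⟨a, w⟩
    change t2Form F (A ⊗[F] B) (k (a, w)) = t2Form F (A ⊗[F] B) (a ⊗ₜ 1)
    rw [hk, QuadraticMap.map_add (t2Form F (A ⊗[F] B)), polar_t2Form_tmul_mapIncl,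
      t2Form_mapIncl hL hLL, add_zero, add_zero]
    intro x hx y hy
    rw [one_mul y, LinearMap.mem_ker.1 hy]
    ring
  · rw [finrank_eq_degree_sq, finrank_eq_degree_sq, degree_tensorProduct,
      Nat.mul_div_cancel' (hA2.mul_right _), mul_pow]
    have h2 := Nat.one_le_pow 2 _ (degree_pos F B)
    obtain ⟨q, hq⟩ := Nat.exists_eq_add_of_le' h2
    rw [hq, Nat.add_sub_cancel]
    ring
  · rw [finrank_tensorProduct_ker]
    refine Nat.div_le_of_le_mul ?_
    rw [← mul_assoc]
    exact Nat.mul_le_mul_right _ (by omega)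

/-- With `t₁(1) = 0` in both factors, all of `A₀ ⊗ 1` is totally singular, and `1 ⊗ b₀`, `a₀ ⊗ 1`
have values `t₂(1_A)`, `t₂(1_B)` and polar value 1. -/
theorem t2Form_tensorProduct_even_even (hA : Even (degree F A)) (hB : Even (degree F B)) :
    (t2Form F (A ⊗[F] B)).Equivalent
      ((binaryForm F ((degree F A).choose 2 : ℕ) ((degree F B).choose 2 : ℕ)).prod
        (hyperbolic F (degree F A ^ 2 * degree F B ^ 2 / 2 - 1))) := by
  obtain ⟨L, hL, hLL, hd⟩ := exists_isotropic_le_ker_reducedTrace F A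
  obtain ⟨a₀, ha₀⟩ := exists_reducedTrace_eq_one (F := F) (A := A)
  obtain ⟨b₀, hb₀⟩ := exists_reducedTrace_eq_one (F := F) (A := B)
  have hAB : Even (degree F (A ⊗[F] B)) := by
    rw [degree_tensorProduct]
    exact hA.mul_right _
  have h1A : reducedTrace F A 1 = 0 := by rw [reducedTrace_one, natCast_of_even hA]
  have h1B : reducedTrace F B 1 = 0 := by rw [reducedTrace_one, natCast_of_even hB]
  obtain ⟨C, hCK', hdis, hCd⟩ := exists_disjoint_finrank_add_eq hL
  have hCK : ∀ c : C, reducedTrace F A c = 0 := fun c => LinearMap.mem_ker.1 (hCK' c.2)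
  have hA2 : 2 ∣ degree F A ^ 2 := (even_iff_two_dvd.1 hA).trans (dvd_pow_self _ two_ne_zero)
  have hA4 : 4 ≤ degree F A ^ 2 :=
    Nat.pow_le_pow_left (Nat.le_of_dvd (degree_pos F A) (even_iff_two_dvd.1 hA)) 2
  have hB4 : 4 ≤ degree F B ^ 2 :=
    Nat.pow_le_pow_left (Nat.le_of_dvd (degree_pos F B) (even_iff_two_dvd.1 hB)) 2
  let W := L ⊗[F] LinearMap.ker (reducedTrace F B)
  let ι : W →ₗ[F] A ⊗[F] B := TensorProduct.mapIncl L (LinearMap.ker (reducedTrace F B))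
  let k : (F × F) × (W × C) →ₗ[F] A ⊗[F] B :=
    ((LinearMap.toSpanSingleton F _ (1 ⊗ₜ b₀)).coprod
      (LinearMap.toSpanSingleton F _ (a₀ ⊗ₜ 1))).coprod
    (ι.coprod ((Algebra.TensorProduct.includeLeft (R := F) (S := F) (A := A) (B := B)).toLinearMap
      ∘ₗ C.subtype))
  have hk : ∀ (x y : F) (w : W) (c : C), k ((x, y), (w, c)) =
      (x • (1 ⊗ₜ b₀) + y • (a₀ ⊗ₜ 1)) + (ι w + (c : A) ⊗ₜ 1) := fun x y w c => rfl
  have hιB : ∀ w, contractRight (reducedTrace F B) (ι w) = 0 := contractRight_mapIncl_ker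
  have hιA : ∀ w, contractLeft (reducedTrace F A) (ι w) = 0 := contractLeft_mapIncl hL _
  refine equivalent_prod_hyperbolic _ _ k ?_ ?_ (fun x hx => eq_zero_of_polar_t2Form hAB x hx) ?_
    (W := W × C) ?_
  · rw [injective_iff_map_eq_zero]
    rintro ⟨⟨x, y⟩, ⟨w, c⟩⟩ h0
    rw [hk] at h0
    have hx := congrArg (contractRight (reducedTrace F B)) h0
    simp only [map_add, map_smul, contractRight_tmul, hιB, h1B, hb₀,
      map_zero, one_smul, zero_smul, smul_zero, add_zero] at hx
    obtain rfl : x = 0 := (smul_eq_zero.1 hx).resolve_right one_ne_zero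
    have hy := congrArg (contractLeft (reducedTrace F A)) h0
    simp only [map_add, map_smul, contractLeft_tmul, hιA, ha₀, hCK,
      map_zero, one_smul, zero_smul, add_zero, zero_add] at hy
    obtain rfl : y = 0 := (smul_eq_zero.1 hy).resolve_right one_ne_zero
    rw [zero_smul, zero_smul, add_zero, zero_add] at h0
    -- The partial trace kills `C ⊗ 1`, so a functional with value 1 at 1 is used instead; it forces
    -- `c ∈ L ∩ C`.
    let f : Module.Dual F B := reducedTrace F B ∘ₗ LinearMap.mulLeft F b₀
    have hf : f 1 = 1 := by simp [f, hb₀]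
    have hc := congrArg (contractRight f) h0
    rw [map_add, contractRight_tmul, hf, one_smul, map_zero] at hc
    have hcL : (c : A) ∈ L := by
      rw [← L.add_mem_iff_right (contractRight_mapIncl_mem f L _ w)]
      exact hc ▸ L.zero_mem
    have hc0 : c = 0 := Subtype.ext (Submodule.disjoint_def.1 hdis c hcL c.2)
    rw [hc0, Submodule.coe_zero, TensorProduct.zero_tmul, add_zero] at h0
    have hw : w = 0 := mapIncl_injective _ _ (h0.trans (map_zero _).symm)
    rw [hw, hc0]
    rfl
  · rintro ⟨⟨x, y⟩, ⟨w, c⟩⟩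
    have e1 : QuadraticMap.polar (t2Form F (A ⊗[F] B)) (1 ⊗ₜ b₀) (ι w) = 0 :=
      polar_t2Form_tmul_mapIncl _ _ (fun u hu v hv => by
        rw [one_mul, LinearMap.mem_ker.1 (hL hu)]; ring) w
    have e2 : QuadraticMap.polar (t2Form F (A ⊗[F] B)) (a₀ ⊗ₜ 1) (ι w) = 0 :=
      polar_t2Form_tmul_mapIncl _ _ (fun u hu v hv => by
        rw [one_mul, LinearMap.mem_ker.1 hv]; ring) w
    have e3 : QuadraticMap.polar (t2Form F (A ⊗[F] B)) ((c : A) ⊗ₜ 1) (ι w) = 0 :=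
      polar_t2Form_tmul_mapIncl _ _ (fun u hu v hv => by
        rw [one_mul, LinearMap.mem_ker.1 hv]; ring) w
    have e4 : t2Form F (A ⊗[F] B) (ι w) = 0 := t2Form_mapIncl hL hLL w
    rw [hk, QuadraticMap.map_add (t2Form F (A ⊗[F] B)),
      QuadraticMap.map_add (t2Form F (A ⊗[F] B)) (x • _),
      QuadraticMap.map_add (t2Form F (A ⊗[F] B)) (ι w)]
    rw [QuadraticMap.polar_comm _ (ι w), e3, e4]
    simp only [QuadraticMap.polar_add_left, QuadraticMap.polar_add_right,
      QuadraticMap.polar_smul_left, QuadraticMap.polar_smul_right, QuadraticMap.map_smul, e1, e2,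
      polar_t2Form_tmul, t2Form_tmul, h1A, h1B, ha₀, hb₀, hCK, binaryForm_apply, one_mul, mul_one,
      t2Form_one, smul_eq_mul]
    linear_combination -(x * y) * CharTwo.two_eq_zero (R := F)
  · rw [finrank_eq_degree_sq, degree_tensorProduct, mul_pow, Nat.mul_sub,
      Nat.mul_div_cancel' (hA2.mul_right _), Module.finrank_prod, Module.finrank_self]
    have := Nat.mul_le_mul hA4 hB4
    omega
  · rw [Module.finrank_prod, finrank_tensorProduct_ker]
    have h3 : Module.finrank F (LinearMap.ker (reducedTrace F A)) + 1 = degree F A ^ 2 :=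
      finrank_ker_reducedTrace F A
    obtain ⟨N, hN⟩ := hA2
    obtain ⟨q, hq⟩ := Nat.exists_eq_add_of_le' (le_trans (by norm_num : 2 ≤ 4) hB4)
    rw [hN, mul_assoc, Nat.mul_div_cancel_left _ two_pos, hq,
      show q + 2 - 1 = q + 1 from rfl]
    -- With `n_A² = 2N` and `n_B² = q + 2`, the singular space has dimension `dim L · q + 2N - 1`,
    -- at least the required `N(q + 2) - 1`. Without `C` the guaranteed bound would be only `N(q +
    -- 1)`.
    have h4 : N ≤ Module.finrank F L := by omega
    have h5 := Nat.mul_le_mul_right q h4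
    have h6 : Module.finrank F L * (q + 1) = Module.finrank F L * q + Module.finrank F L := by ring
    have h7 : N * (q + 2) = N * q + 2 * N := by ring
    omega

end Decomposition

lemma secondTraceForm_tensorProduct_comm {F A B : Type*} [Field F] [Ring A] [Algebra F A]
    [Algebra.IsCentral F A] [IsSimpleRing A] [FiniteDimensional F A] [Ring B] [Algebra F B]
    [Algebra.IsCentral F B] [IsSimpleRing B] [FiniteDimensional F B] (hA : Even (degree F A)) :
    (secondTraceForm F (A ⊗[F] B)).Equivalent (secondTraceForm F (B ⊗[F] A)) := by
  have hAB : Even (degree F (A ⊗[F] B)) := by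
    rw [degree_tensorProduct]
    exact hA.mul_right _
  have hBA : Even (degree F (B ⊗[F] A)) := by
    rw [degree_tensorProduct]
    exact hA.mul_left _
  have h : (t2Form F (A ⊗[F] B)).Equivalent (t2Form F (B ⊗[F] A)) :=
    ⟨{ (Algebra.TensorProduct.comm F A B).toLinearEquiv with
        map_app' := t2Form_algEquiv (Algebra.TensorProduct.comm F A B) }⟩
  exact (secondTraceForm_equivalent_t2Form F _ hAB).trans
    (h.trans (secondTraceForm_equivalent_t2Form F _ hBA).symm)

/-! ### Identification of the forms case by case modulo 4. -/

section Isometry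

variable {F A B : Type*} [Field F] [CharP F 2] [Ring A] [Algebra F A] [Algebra.IsCentral F A]
  [IsSimpleRing A] [FiniteDimensional F A] [Ring B] [Algebra F B] [Algebra.IsCentral F B]
  [IsSimpleRing B] [FiniteDimensional F B]

lemma secondTraceForm_tensorProduct_even_even (hA : Even (degree F A)) (hB : Even (degree F B)) :
    (secondTraceForm F (A ⊗[F] B)).Equivalent
      ((binaryForm F ((degree F A).choose 2 : ℕ) ((degree F B).choose 2 : ℕ)).prod
        (hyperbolic F (degree F A ^ 2 * degree F B ^ 2 / 2 - 1))) := by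
  have hAB : Even (degree F (A ⊗[F] B)) := by
    rw [degree_tensorProduct]
    exact hA.mul_right _
  exact (secondTraceForm_equivalent_t2Form F _ hAB).trans (t2Form_tensorProduct_even_even hA hB)

lemma secondTraceForm_tensorProduct_even_odd (hA : Even (degree F A)) (hB : Odd (degree F B)) :
    (secondTraceForm F (A ⊗[F] B)).Equivalent
      ((t2FormLeft F A B).prod (hyperbolic F (degree F A ^ 2 * (degree F B ^ 2 - 1) / 2))) := by
  have hAB : Even (degree F (A ⊗[F] B)) := by
    rw [degree_tensorProduct]
    exact hA.mul_right _
  exact (secondTraceForm_equivalent_t2Form F _ hAB).trans (t2Form_tensorProduct_even_odd hA hB)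

theorem secondTraceForm_tensorProduct_two_two (hA : degree F A % 4 = 2) (hB : degree F B % 4 = 2) :
    (secondTraceForm F (A ⊗[F] B)).Equivalent
      ((binaryForm F 1 1).prod (hyperbolic F (degree F A ^ 2 * degree F B ^ 2 / 2 - 1))) := by
  have h := secondTraceForm_tensorProduct_even_even (F := F) (A := A) (B := B)
    (Nat.even_iff.2 (by omega)) (Nat.even_iff.2 (by omega))
  rwa [cast_choose_two, cast_choose_two, if_neg (by omega), if_neg (by omega)] at h

theorem secondTraceForm_tensorProduct_hyperbolic
    (h : (degree F A % 4 = 0 ∧ Even (degree F B)) ∨ (degree F B % 4 = 0 ∧ Even (degree F A))) :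
    (secondTraceForm F (A ⊗[F] B)).Equivalent
      (hyperbolic F (degree F A ^ 2 * degree F B ^ 2 / 2)) := by
  simp only [Nat.even_iff] at h
  have hA : Even (degree F A) := Nat.even_iff.2 (by omega)
  have hB : Even (degree F B) := Nat.even_iff.2 (by omega)
  have hA2 : 2 ≤ degree F A := Nat.le_of_dvd (degree_pos F A) (even_iff_two_dvd.1 hA)
  have hB2 : 2 ≤ degree F B := Nat.le_of_dvd (degree_pos F B) (even_iff_two_dvd.1 hB)
  have hpos : 1 ≤ degree F A ^ 2 * degree F B ^ 2 / 2 :=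
    (by norm_num : 1 ≤ 2 ^ 2 * 2 ^ 2 / 2).trans
      (Nat.div_le_div_right (Nat.mul_le_mul (Nat.pow_le_pow_left hA2 2) (Nat.pow_le_pow_left hB2 2)))
  obtain ⟨m, hm⟩ := Nat.exists_eq_add_of_le' hpos
  have hplane : (binaryForm F ((degree F A).choose 2 : ℕ) ((degree F B).choose 2 : ℕ)).Equivalent
      (binaryForm F 0 0) := by
    rcases h with h | h
    · rw [cast_choose_two (degree F A), if_pos (by omega)]
      exact binaryForm_zero_left_equivalent _
    · rw [cast_choose_two (degree F B), if_pos (by omega)]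
      exact binaryForm_zero_right_equivalent _
  have h' := secondTraceForm_tensorProduct_even_even (F := F) (A := A) (B := B) hA hB
  rw [hm, Nat.add_sub_cancel] at h'
  rw [hm]
  exact h'.trans ((hplane.prod (QuadraticMap.Equivalent.refl _)).trans
    (hyperbolic_succ_equivalent m).symm)

/-- If `n_B ≡ 1 mod 4` the added multiple of `t₁²` is zero. Otherwise `n_A ≡ 0 mod 4`, so `t₂(1) =
0` and the twist by `v = 1` absorbs it. -/
lemma t2FormLeft_equivalent
    (h : (degree F A % 4 = 0 ∧ Odd (degree F B)) ∨ (degree F A % 4 = 2 ∧ degree F B % 4 = 1)) :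
    (t2FormLeft F A B).Equivalent (t2Form F A) := by
  have hA : Even (degree F A) := Nat.even_iff.2 (by omega)
  have hB : Odd (degree F B) := by
    rw [Nat.odd_iff] at *
    omega
  by_cases hB1 : degree F B % 4 < 2
  · have : t2FormLeft F A B = t2Form F A := by
      ext a
      rw [t2FormLeft_apply hB, cast_choose_two, if_pos hB1, mul_zero, add_zero]
    rw [this]
  · refine equivalent_of_add_sq_polar 1 ?_ fun a => ?_
    · rw [t2Form_one, cast_choose_two, if_pos (by omega)]
    · rw [t2FormLeft_apply hB, cast_choose_two, if_neg hB1, mul_one, polar_t2Form_one_right hA]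

theorem secondTraceForm_tensorProduct_mixed
    (h : (degree F A % 4 = 0 ∧ Odd (degree F B)) ∨ (degree F A % 4 = 2 ∧ degree F B % 4 = 1)) :
    (secondTraceForm F (A ⊗[F] B)).Equivalent
      ((secondTraceForm F A).prod (hyperbolic F (degree F A ^ 2 * (degree F B ^ 2 - 1) / 2))) := by
  have hA : Even (degree F A) := Nat.even_iff.2 (by omega)
  have hB : Odd (degree F B) := by
    rw [Nat.odd_iff] at *
    omega
  exact (secondTraceForm_tensorProduct_even_odd hA hB).trans
    (((t2FormLeft_equivalent h).trans (secondTraceForm_equivalent_t2Form F A hA).symm).prod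
      (QuadraticMap.Equivalent.refl _))

/-- Here `t₂(1) = 1`, so the twist by `v = 1` consumes one hyperbolic plane and produces `[1,1]`. -/
theorem secondTraceForm_tensorProduct_two_three (h2 : degree F A % 4 = 2)
    (h3 : degree F B % 4 = 3) :
    (secondTraceForm F (A ⊗[F] B)).Equivalent
      (((binaryForm F 1 1).prod (secondTraceForm F A)).prod
        (hyperbolic F (degree F A ^ 2 * (degree F B ^ 2 - 1) / 2 - 1))) := by
  have hA : Even (degree F A) := Nat.even_iff.2 (by omega)
  have hB : Odd (degree F B) := Nat.odd_iff.2 (by omega)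
  have hpos : 1 ≤ degree F A ^ 2 * (degree F B ^ 2 - 1) / 2 := by
    have hA2 : 2 ^ 2 ≤ degree F A ^ 2 := Nat.pow_le_pow_left (by omega) 2
    have hB3 : 3 ^ 2 ≤ degree F B ^ 2 := Nat.pow_le_pow_left (by omega) 2
    refine (by norm_num : 1 ≤ 2 ^ 2 * (3 ^ 2 - 1) / 2).trans
      (Nat.div_le_div_right (Nat.mul_le_mul hA2 (Nat.sub_le_sub_right hB3 1)))
  obtain ⟨m, hm⟩ := Nat.exists_eq_add_of_le' hpos
  have h' := secondTraceForm_tensorProduct_even_odd hA hB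
  rw [hm] at h' ⊢
  rw [Nat.add_sub_cancel]
  have hq : ((t2FormLeft F A B).prod (binaryForm F 0 0)).Equivalent
      ((binaryForm F 1 1).prod (t2Form F A)) := by
    refine prod_equivalent_of_add_sq_polar 1 ?_ fun a => ?_
    · rw [t2Form_one, cast_choose_two, if_neg (by omega)]
    · rw [t2FormLeft_apply hB, cast_choose_two, if_neg (by omega), mul_one,
        polar_t2Form_one_right hA]
  refine h'.trans (((QuadraticMap.Equivalent.refl _).prod (hyperbolic_succ_equivalent m)).trans
    ((prod_assoc_equivalent _ _ _).symm.trans (QuadraticMap.Equivalent.prod (hq.trans ?_)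
      (QuadraticMap.Equivalent.refl _))))
  exact (QuadraticMap.Equivalent.refl _).prod (secondTraceForm_equivalent_t2Form F A hA).symm

end Isometry

end SecondTrace

end

theorem theorem2 {F : Type u} [Field F] [CharP F 2]
    (A₁ : Type v) [Ring A₁] [Algebra F A₁] [Algebra.IsCentral F A₁] [IsSimpleRing A₁]
    [FiniteDimensional F A₁]
    (A₂ : Type w) [Ring A₂] [Algebra F A₂] [Algebra.IsCentral F A₂] [IsSimpleRing A₂]
    [FiniteDimensional F A₂]
    (n₁ n₂ : ℕ) (hn₁ : SecondTrace.degree F A₁ = n₁) (hn₂ : SecondTrace.degree F A₂ = n₂) :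
    -- both degrees odd
    (Odd n₁ → Odd n₂ →
      (SecondTrace.secondTraceForm F (A₁ ⊗[F] A₂)).Equivalent
        (((SecondTrace.secondTraceForm F A₁).prod (SecondTrace.secondTraceForm F A₂)).prod
          (SecondTrace.hyperbolic F ((n₁ ^ 2 - 1) * (n₂ ^ 2 - 1) / 2)))) ∧
    -- both degrees congruent to 2 modulo 4
    (n₁ % 4 = 2 → n₂ % 4 = 2 →
      (SecondTrace.secondTraceForm F (A₁ ⊗[F] A₂)).Equivalent
        ((SecondTrace.binaryForm F 1 1).prod
          (SecondTrace.hyperbolic F (n₁ ^ 2 * n₂ ^ 2 / 2 - 1)))) ∧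
    -- one degree divisible by 4, the other even
    ((n₁ % 4 = 0 ∧ Even n₂) ∨ (n₂ % 4 = 0 ∧ Even n₁) →
      (SecondTrace.secondTraceForm F (A₁ ⊗[F] A₂)).Equivalent
        (SecondTrace.hyperbolic F (n₁ ^ 2 * n₂ ^ 2 / 2))) ∧
    -- mixed parity, without the summand [1,1], for (i, j) = (1, 2) and (i, j) = (2, 1)
    ((n₁ % 4 = 0 ∧ Odd n₂) ∨ (n₁ % 4 = 2 ∧ n₂ % 4 = 1) →
      (SecondTrace.secondTraceForm F (A₁ ⊗[F] A₂)).Equivalent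
        ((SecondTrace.secondTraceForm F A₁).prod
          (SecondTrace.hyperbolic F (n₁ ^ 2 * (n₂ ^ 2 - 1) / 2)))) ∧
    ((n₂ % 4 = 0 ∧ Odd n₁) ∨ (n₂ % 4 = 2 ∧ n₁ % 4 = 1) →
      (SecondTrace.secondTraceForm F (A₁ ⊗[F] A₂)).Equivalent
        ((SecondTrace.secondTraceForm F A₂).prod
          (SecondTrace.hyperbolic F (n₂ ^ 2 * (n₁ ^ 2 - 1) / 2)))) ∧
    -- mixed parity, with the summand [1,1], for (i, j) = (1, 2) and (i, j) = (2, 1)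
    (n₁ % 4 = 2 → n₂ % 4 = 3 →
      (SecondTrace.secondTraceForm F (A₁ ⊗[F] A₂)).Equivalent
        (((SecondTrace.binaryForm F 1 1).prod (SecondTrace.secondTraceForm F A₁)).prod
          (SecondTrace.hyperbolic F (n₁ ^ 2 * (n₂ ^ 2 - 1) / 2 - 1)))) ∧
    (n₂ % 4 = 2 → n₁ % 4 = 3 →
      (SecondTrace.secondTraceForm F (A₁ ⊗[F] A₂)).Equivalent
        (((SecondTrace.binaryForm F 1 1).prod (SecondTrace.secondTraceForm F A₂)).prod
          (SecondTrace.hyperbolic F (n₂ ^ 2 * (n₁ ^ 2 - 1) / 2 - 1)))) := by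
  subst hn₁ hn₂
  refine ⟨fun h₁ h₂ => SecondTrace.secondTraceForm_tensorProduct_odd_odd h₁ h₂,
    fun h₁ h₂ => SecondTrace.secondTraceForm_tensorProduct_two_two h₁ h₂,
    fun h => SecondTrace.secondTraceForm_tensorProduct_hyperbolic h,
    fun h => SecondTrace.secondTraceForm_tensorProduct_mixed h, fun h => ?_,
    fun h₁ h₂ => SecondTrace.secondTraceForm_tensorProduct_two_three h₁ h₂, fun h₂ h₁ => ?_⟩
  · exact (SecondTrace.secondTraceForm_tensorProduct_comm (Nat.even_iff.2 (by omega))).symm.trans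
      (SecondTrace.secondTraceForm_tensorProduct_mixed h)
  · exact (SecondTrace.secondTraceForm_tensorProduct_comm (Nat.even_iff.2 (by omega))).symm.trans
      (SecondTrace.secondTraceForm_tensorProduct_two_three h₂ h₁)
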